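/- Let $L$ be a countable first-order language with equality, $M$ an infinite $L$-structure, and $\mathrm{cl}:\mathcal P(M)\to\mathcal P(M)$ a function such that $(M,\mathrm{cl})$ is a \emph{sufficient pregeometry}, i.e.: (a) $\mathrm{cl}$ is a formula-based closure relation: for all $A,B\subseteq M$, $A\subseteq\mathrm{cl}(A)$; $A\subseteq B$ implies $\mathrm{cl}(A)\subseteq\mathrm{cl}(B)$; $\mathrm{cl}(\mathrm{cl}(A))=\mathrm{cl}(A)$; and whenever $a\in\mathrm{cl}(B)$ there are a finite tuple $\bar b$ from $B$ and an $L$-formula $\varphi(x,\bar y)$ with $M\models\varphi(a,\bar b)$ which is a \emph{closure formula}, meaning that $a'\in\mathrm{cl}(\bar b')$ whenever $M\models\varphi(a',\bar b')$; (b) (exchange) if $a\in\mathrm{cl}(B\cup\{c\})\setminus\mathrm{cl}(B)$, then $c\in\mathrm{cl}(B\cup\{a\})$; (c) (extendibility) $\mathrm{cl}(\emptyset)\neq M$; (d) (weak homogeneity) for every finite tuple $\bar b$ from $M$ and every $L$-formula $\varphi(w,\bar y)$, if $M\models\varphi(a,\bar b)$ for some $a\notin\mathrm{cl}(\bar b)$,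 then for every finite $E\subseteq M$ there is $a'\notin\mathrm{cl}(E)$ with $M\models\varphi(a',\bar b)$. Let $\{\Delta_m(\bar w_m):m\in\omega\}$ be a countable set of partial types over $\emptyset$ (each a set of $L$-formulas in a finite tuple $\bar w_m$ of variables), each omitted in $M$. Then there is an $L$-structure $N\equiv M$ of cardinality $2^{\aleph_0}$ such that: (1) $N$ is Borel: there are a standard Borel space $Z$, a Borel set $D\subseteq Z$ and an equivalence relation $E$ on $D$, Borel in $Z^2$, such that the universe of $N$ is $D/E$ and, for every $k$, the preimage in $Z^k$ of every subset of $N^k$ defined by an atomic $L$-formula is Borel; (2) there is a subset $\{a_\eta:\eta\in 2^\omega\}$ of $N$, with $a_\eta\ne a_\tau$ for $\eta\neq\tau$, which is - $\mathrm{cl}$-independent: for no $\eta$ is there a closure formula $\varphi(x,\bar y)$ for $(M,\mathrm{cl})$ and a finite tuple $\bar b$ from $\{a_\tau:\tau\ne\eta\}$ with $N\models\varphi(a_\eta,\bar b)$; - asymptotically similar: for every $k$ and every $L$-formula $\theta$ in $k$ free variables there is an integer $N_\theta$ such that for all $\ell\ge N_\theta$ we have $N\models\theta(a_{\eta_0},\dots,a_{\eta_{k-1}})\leftrightarrow\theta(a_{\tau_0},\dots,a_{\tau_{k-1}})$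 whenever $\eta_0,\dots,\eta_{k-1}\in 2^\omega$ have pairwise distinct restrictions to $\ell$ and $\tau_0,\dots,\tau_{k-1}\in 2^\omega$ satisfy $\tau_i{\restriction}\ell=\eta_i{\restriction}\ell$ for all $i<k$; (3) if $M$ is atomic (every finite tuple of $M$ realizes a formula that is complete with respect to $\mathrm{Th}(M)$), then $N$ is atomic; (4) $N$ omits every $\Delta_m$. -/

import Mathlib

open scoped FirstOrder

universe u v w w'

/-! ### Closure relations defined by formulas -/

/-- A formula `φ(x, y₁, …, yₙ)` (variable `0` is `x`, the others are the `yᵢ`) is a *closure formula*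
for `(M, cl)` if `a ∈ cl(b₁, …, bₙ)` whenever `M ⊨ φ(a, b₁, …, bₙ)`. -/
def IsClosureFormula {L : FirstOrder.Language.{u, v}} {M : Type w} [L.Structure M]
    (cl : ClosureOperator (Set M)) {n : ℕ} (φ : L.Formula (Fin (n + 1))) : Prop :=
  ∀ (a : M) (b : Fin n → M), φ.Realize (Fin.cons a b : Fin (n + 1) → M) → a ∈ cl (Set.range b)

/-- A closure operator on the subsets of `M` (extensive, monotone, idempotent) is *formula-based* if
every instance `a ∈ cl B` is witnessed by a finite tuple `b` from `B` and a closure formula that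
holds of `(a, b)`. -/
def IsFormulaBased (L : FirstOrder.Language.{u, v}) {M : Type w} [L.Structure M]
    (cl : ClosureOperator (Set M)) : Prop :=
  ∀ (B : Set M) (a : M), a ∈ cl B →
    ∃ (n : ℕ) (b : Fin n → M) (φ : L.Formula (Fin (n + 1))), (∀ i, b i ∈ B) ∧
      φ.Realize (Fin.cons a b : Fin (n + 1) → M) ∧ IsClosureFormula cl φ

/-- Sufficient pregeometries: formula-based closure relations on an infinite structure satisfying
exchange, extendibility and weak homogeneity. -/
structure IsSufficientPregeometry (L : FirstOrder.Language.{u, v}) {M : Type w} [L.Structure M]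
    (cl : ClosureOperator (Set M)) : Prop where
  infinite : Infinite M
  formulaBased : IsFormulaBased L cl
  exchange : ∀ (B : Set M) (a c : M),
    a ∈ cl (insert c B) → a ∉ cl B → c ∈ cl (insert a B)
  extendible : ∃ a : M, a ∉ cl ∅
  weaklyHomogeneous : ∀ (n : ℕ) (b : Fin n → M) (φ : L.Formula (Fin (n + 1))),
    (∃ a : M, a ∉ cl (Set.range b) ∧ φ.Realize (Fin.cons a b : Fin (n + 1) → M)) →
      ∀ E : Set M, E.Finite →
        ∃ a' : M, a' ∉ cl E ∧ φ.Realize (Fin.cons a' b : Fin (n + 1) → M)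

/-- The interpretation in another `L`-structure `N` of the closure relation of `(M, cl)`: an element
`a` is in the closure of `B` if some closure formula for `(M, cl)` holds in `N` of `a` and a finite
tuple from `B`. -/
def transferredClosure (L : FirstOrder.Language.{u, v}) {M : Type w} [L.Structure M]
    (cl : ClosureOperator (Set M)) (N : Type w') [L.Structure N] (B : Set N) : Set N :=
  {a | ∃ (n : ℕ) (b : Fin n → N) (φ : L.Formula (Fin (n + 1))), IsClosureFormula cl φ ∧
    (∀ i, b i ∈ B) ∧ φ.Realize (Fin.cons a b : Fin (n + 1) → N)}

/-- On `M` itself, the transferred closure of a formula-based closure relation is that relation. -/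
theorem transferredClosure_self (L : FirstOrder.Language.{u, v}) {M : Type w} [L.Structure M]
    {cl : ClosureOperator (Set M)} (h : IsFormulaBased L cl) (B : Set M) :
    transferredClosure L cl M B = cl B := by
  ext a
  constructor
  · rintro ⟨n, b, φ, hφ, hb, ha⟩
    exact cl.monotone (Set.range_subset_iff.2 hb) (hφ a b ha)
  · intro ha
    obtain ⟨n, b, φ, hb, hr, hφ⟩ := h B a ha
    exact ⟨n, b, φ, hφ, hb, hr⟩

/-- A subset `S` of `N` is independent for the closure relation transferred from `(M, cl)`. -/
def IsClIndependent (L : FirstOrder.Language.{u, v}) {M : Type w} [L.Structure M]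
    (cl : ClosureOperator (Set M)) {N : Type w'} [L.Structure N] (S : Set N) : Prop :=
  ∀ a ∈ S, a ∉ transferredClosure L cl N (S \ {a})

/-! ### Borel structures -/

/-- A structure is *Borel* if it has a presentation as `D / E`, with `D` a Borel subset of a standard
Borel space `Z` and `E` an equivalence relation on `D` that is Borel in `Z × Z`, such that the
preimage of every set of tuples defined by an atomic formula is Borel. -/
def IsBorelStructure (L : FirstOrder.Language.{u, v}) (N : Type w) [L.Structure N] : Prop :=
  ∃ (Z : Type) (_ : MeasurableSpace Z) (_ : StandardBorelSpace Z) (D : Set Z) (E : Setoid D)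
    (e : Quotient E ≃ N),
    MeasurableSet D ∧
    MeasurableSet {p : Z × Z | ∃ (h₁ : p.1 ∈ D) (h₂ : p.2 ∈ D), E ⟨p.1, h₁⟩ ⟨p.2, h₂⟩} ∧
    ∀ (k : ℕ) (φ : L.Formula (Fin k)), FirstOrder.Language.BoundedFormula.IsAtomic φ →
      MeasurableSet {z : Fin k → Z | ∃ h : ∀ i, z i ∈ D,
        φ.Realize (fun i => e (Quotient.mk E ⟨z i, h i⟩))}

/-! ### Asymptotic similarity -/

/-- A tuple of elements of `2^ω` *splits by* `ℓ` if the restrictions to `ℓ` of its entries are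
pairwise distinct (so that the entries are distinct, too). -/
def SplitsBy (ℓ : ℕ) {k : ℕ} (η : Fin k → ℕ → Bool) : Prop :=
  Function.Injective fun (i : Fin k) (j : Fin ℓ) => η i j

/-- Two tuples of elements of `2^ω` are *similar (mod `ℓ`)*. -/
def SimilarMod (ℓ : ℕ) {k : ℕ} (η τ : Fin k → ℕ → Bool) : Prop :=
  SplitsBy ℓ η ∧ ∀ (i : Fin k) (j : ℕ), j < ℓ → η i j = τ i j

/-- A family `(a_η)` of elements of `N`, indexed by `2^ω`, is *asymptotically similar*. -/
def IsAsymptoticallySimilar (L : FirstOrder.Language.{u, v}) {N : Type w} [L.Structure N]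
    (a : (ℕ → Bool) → N) : Prop :=
  ∀ (k : ℕ) (θ : L.Formula (Fin k)), ∃ n : ℕ, ∀ ℓ ≥ n, ∀ η τ : Fin k → ℕ → Bool,
    SimilarMod ℓ η τ → (θ.Realize (fun i => a (η i)) ↔ θ.Realize (fun i => a (τ i)))

/-! ### Atomic models and omitting types -/

/-- A formula is *complete* with respect to a theory `T` if `T` proves that it is realized, and it
decides over `T` every formula in the same variables. -/
def IsCompleteFormula {L : FirstOrder.Language.{u, v}} (T : L.Theory) {n : ℕ} (φ : L.Formula (Fin n)) : Prop :=
  T ⊨ᵇ FirstOrder.Language.Formula.iExs (Fin n) (φ.relabel (Sum.inr : Fin n → Empty ⊕ Fin n)) ∧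
    ∀ δ : L.Formula (Fin n), T ⊨ᵇ φ.imp δ ∨ T ⊨ᵇ φ.imp δ.not

/-- A structure is *atomic* if each of its finite tuples realizes a formula that is complete with
respect to its theory. -/
def IsAtomicModel (L : FirstOrder.Language.{u, v}) (N : Type w) [L.Structure N] : Prop :=
  ∀ (n : ℕ) (a : Fin n → N), ∃ φ : L.Formula (Fin n),
    IsCompleteFormula (L.completeTheory N) φ ∧ φ.Realize a

/-- A structure *omits* a set `Δ` of formulas in `n` variables if none of its `n`-tuples satisfies
all formulas of `Δ`. -/
def OmitsType {L : FirstOrder.Language.{u, v}} (N : Type w) [L.Structure N] {n : ℕ}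
    (Δ : Set (L.Formula (Fin n))) : Prop :=
  ∀ a : Fin n → N, ∃ φ ∈ Δ, ¬ φ.Realize a

/-! `N` is built as a limit of finite approximations inside `M`. In an approximation, finitely many
names carry values in `M`; a definable set `P` records which assignments are admissible. Each name
rests on a finite set of nodes and lies, under every admissible assignment, in the closure of the
free names whose support is contained in its own. To pass on, one node is split: names resting on it
are doubled, the others are shared (`Approx.exists_split`). Weak homogeneity and exchange make the
copied free names independent of the old ones (`exists_mem_independent`). Then witnesses are added,
free or bound by a closure formula (`Approx.exists_witness`), and `P` is shrunk so that facts about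
the current values hold of all admissible assignments (`Approx.exists_shrink`).

A point is a name together with a binary sequence saying which copy to follow. The main fact is
stabilization (`Tower.exists_stableFrom`): supports never grow in size, so a finite family of points
occupies a bounded number of nodes, and this number never drops. Once it is constant, no split
separates two members of the family, so all of them may be taken to follow one common sequence of
choices, and whatever `P` guarantees for the tuple persists. Hence truth values converge. The points
form an elementary substructure of an ultrapower of `M`, and convergence makes truth of a formula a
Borel condition on points.

The branches of the root are free names resting on a single node each. Distinct branches eventually
have distinct, hence independent, names; a tuple that splits by `ℓ` is stable from step `2 ^ ℓ - 1`
on, where its names depend only on the restrictions to `ℓ`. This gives independence and asymptotic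
similarity. Omitting types and atomicity are obtained by confining tuples to members of definable
covers. -/

/-! ### Independence in sufficient pregeometries -/

namespace IsSufficientPregeometry

variable {L : FirstOrder.Language.{u, v}} {M : Type w} [L.Structure M]
  {cl : ClosureOperator (Set M)}

theorem notMem_closure_insert (hcl : IsSufficientPregeometry L cl) {B : Set M} {a c : M}
    (ha : a ∉ cl B) (hc : c ∉ cl (insert a B)) : a ∉ cl (insert c B) :=
  fun h => hc (hcl.exchange B a c h ha)

/-- The elements `u j` are adjoined to `B` one at a time; by exchange, none of them can bring `a`
into the closure. -/
theorem notMem_closure_union_image (hcl : IsSufficientPregeometry L cl) {ι : Type*} {B : Set M}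
    {a : M} (ha : a ∉ cl B) (u : ι → M) (W : Finset ι)
    (hW : ∀ j ∈ W, u j ∉ cl (insert a (B ∪ u '' (W \ {j})))) : a ∉ cl (B ∪ u '' W) := by
  classical
  induction W using Finset.induction_on with
  | empty => simpa using ha
  | insert j W hj ih =>
    have h₁ : a ∉ cl (B ∪ u '' W) := by
      refine ih fun i hi h => hW i (Finset.mem_insert_of_mem hi) (cl.monotone ?_ h)
      gcongr
      simp
    have h₂ : u j ∉ cl (insert a (B ∪ u '' W)) := by
      intro h
      refine hW j (Finset.mem_insert_self _ _) (cl.monotone ?_ h)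
      gcongr
      intro i hi
      exact ⟨by simp [Finset.mem_coe.1 hi], fun h => hj (h ▸ hi)⟩
    have := hcl.notMem_closure_insert h₁ h₂
    rwa [Finset.coe_insert, Set.image_insert_eq, Set.union_insert]

/-- Weak homogeneity for definable sets: a coordinate of a point of a definable set which is not in
the closure of the other coordinates can be moved out of the closure of any finite set. -/
theorem exists_update_mem (hcl : IsSufficientPregeometry L cl) {ι : Type*} [Finite ι]
    [DecidableEq ι] {P : Set (ι → M)} (hP : (∅ : Set M).Definable L P) {w : ι → M} (hw : w ∈ P)
    (i : ι) (hi : w i ∉ cl (w '' {i}ᶜ)) {E : Set M} (hE : E.Finite) :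
    ∃ a ∉ cl E, Function.update w i a ∈ P := by
  obtain ⟨φ, rfl⟩ := Set.empty_definable_iff.1 hP
  obtain ⟨n, ⟨e⟩⟩ := Finite.exists_equiv_fin {j // j ≠ i}
  let g : ι → Fin (n + 1) := fun j => if h : j = i then 0 else (e ⟨j, h⟩).succ
  let b : Fin n → M := fun m => w (e.symm m)
  have hg : ∀ a : M, (Fin.cons a b : Fin (n + 1) → M) ∘ g = Function.update w i a := by
    intro a
    ext j
    by_cases h : j = i
    · subst h
      simp [g]
    · simp [g, h, b]
  have hb : Set.range b ⊆ w '' {i}ᶜ := by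
    rintro _ ⟨m, rfl⟩
    exact ⟨_, (e.symm m).2, rfl⟩
  obtain ⟨a, ha, haφ⟩ := hcl.weaklyHomogeneous n b (φ.relabel g)
    ⟨w i, fun h => hi (cl.monotone hb h), by
      rw [FirstOrder.Language.Formula.realize_relabel, hg, Function.update_eq_self]
      exact hw⟩ E hE
  refine ⟨a, ha, ?_⟩
  rw [FirstOrder.Language.Formula.realize_relabel, hg] at haφ
  exact haφ

/-- Simultaneous weak homogeneity for an independent block of coordinates. -/
theorem exists_mem_independent (hcl : IsSufficientPregeometry L cl) {ι : Type*} [Finite ι]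
    {P : Set (ι → M)} (hP : (∅ : Set M).Definable L P) {w : ι → M} (hw : w ∈ P) (W : Finset ι)
    (hW : ∀ i ∈ W, w i ∉ cl (w '' {i}ᶜ)) {E : Set M} (hE : E.Finite) :
    ∃ w' ∈ P, (∀ i ∉ W, w' i = w i) ∧ ∀ i ∈ W, w' i ∉ cl (E ∪ w' '' {i}ᶜ) := by
  classical
  suffices ∀ R ⊆ W, ∃ w' ∈ P, (∀ i ∉ W, w' i = w i) ∧ (∀ i ∈ W, w' i ∉ cl (w' '' {i}ᶜ)) ∧
      ∀ i ∈ R, w' i ∉ cl (E ∪ w' '' {i}ᶜ) by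
    obtain ⟨w', h₁, h₂, -, h₃⟩ := this W subset_rfl
    exact ⟨w', h₁, h₂, h₃⟩
  intro R
  induction R using Finset.induction_on with
  | empty => exact fun _ => ⟨w, hw, fun _ _ => rfl, hW, by simp⟩
  | insert j R hj ih =>
    intro hR
    obtain ⟨w', hP', hoff, hind, hR'⟩ := ih fun i hi => hR (Finset.mem_insert_of_mem hi)
    have hjW : j ∈ W := hR (Finset.mem_insert_self _ _)
    -- The new value avoids the closure of `E` together with all old coordinates, so that exchange
    -- can protect the independence of the coordinates that stay put.
    obtain ⟨a, ha, haP⟩ := hcl.exists_update_mem hP hP' j (hind j hjW)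
      (hE.union ((Set.toFinite {j}ᶜ).image w'))
    have himg : Function.update w' j a '' {j}ᶜ = w' '' {j}ᶜ :=
      Set.image_congr fun i hi => Function.update_of_ne hi _ _
    -- Needed twice: `E' = ∅` for all of `W`, including coordinates not yet moved, and `E' = E` for
    -- those already moved.
    have key : ∀ E' ⊆ E, ∀ i, i ≠ j → w' i ∉ cl (E' ∪ w' '' {i}ᶜ) →
        w' i ∉ cl (E' ∪ Function.update w' j a '' {i}ᶜ) := by
      intro E' hE' i hij hi
      have hsub : E' ∪ Function.update w' j a '' {i}ᶜ ⊆ insert a (E' ∪ w' '' {i, j}ᶜ) := by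
        rintro x (hx | ⟨m, hm, rfl⟩)
        · exact Or.inr (Or.inl hx)
        · by_cases hmj : m = j
          · subst hmj
            simp
          · rw [Function.update_of_ne hmj]
            exact Or.inr (Or.inr ⟨m, by simpa [hmj] using hm, rfl⟩)
      refine fun h => hcl.notMem_closure_insert (a := w' i) (c := a) (B := E' ∪ w' '' {i, j}ᶜ)
        (fun h => hi (cl.monotone ?_ h)) (fun h => ha (cl.monotone ?_ h)) (cl.monotone hsub h)
      · gcongr
        simp
      · rintro x (rfl | hx | ⟨m, hm, rfl⟩)
        · exact Or.inr ⟨i, hij, rfl⟩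
        · exact Or.inl (hE' hx)
        · exact Or.inr ⟨m, fun h => hm (Or.inr h), rfl⟩
    have hja : ∀ E' ⊆ E, Function.update w' j a j ∉ cl (E' ∪ Function.update w' j a '' {j}ᶜ) := by
      intro E' hE' h
      rw [himg, Function.update_self] at h
      exact ha (cl.monotone (by gcongr) h)
    refine ⟨_, haP, fun i hi => ?_, fun i hi => ?_, fun i hi => ?_⟩
    · rw [Function.update_of_ne (by rintro rfl; exact hi hjW), hoff i hi]
    · by_cases hij : i = j
      · subst hij
        simpa using hja ∅ (Set.empty_subset _)
      · rw [Function.update_of_ne hij]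
        simpa using key ∅ (Set.empty_subset _) i hij (by simpa using hind i hi)
    · by_cases hij : i = j
      · subst hij
        exact hja E subset_rfl
      · rw [Function.update_of_ne hij]
        exact key E subset_rfl i hij (hR' i ((Finset.mem_insert.1 hi).resolve_left hij))

end IsSufficientPregeometry

/-! ### Finite approximations -/

/-- A finite approximation: finitely many names for elements of `M`, with a support (a finite set of
nodes), a set of free names whose values are independent, and a definable set `P` of admissible
assignments, in each of which every name takes a value in the closure of the values of the free names
with smaller support. -/
structure Approx (L : FirstOrder.Language.{u, v}) {M : Type w} [L.Structure M]
    (cl : ClosureOperator (Set M)) where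
  Name : Type
  finite : Finite Name
  val : Name → M
  supp : Name → Finset ℕ
  free : Set Name
  P : Set (Name → M)
  definable : (∅ : Set M).Definable L P
  val_mem : val ∈ P
  independent : ∀ i ∈ free, val i ∉ cl (val '' (free \ {i}))
  spanned : ∀ w ∈ P, ∀ i, w i ∈ cl (w '' {j ∈ free | supp j ⊆ supp i})

namespace Approx

attribute [instance] Approx.finite

variable {L : FirstOrder.Language.{u, v}} {M : Type w} [L.Structure M]
  {cl : ClosureOperator (Set M)}

/-- A map of names under which admissible assignments restrict to admissible assignments, and which
acts on supports by the map `g` of nodes. -/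
structure Refines (S T : Approx L cl) (g : ℕ → ℕ) (e : S.Name → T.Name) : Prop where
  restrict : ∀ w ∈ T.P, w ∘ e ∈ S.P
  free : ∀ i ∈ S.free, e i ∈ T.free
  supp : ∀ i, T.supp (e i) = (S.supp i).image g

/-- All supports are contained in `A`. -/
def SuppIn (S : Approx L cl) (A : Finset ℕ) : Prop := ∀ i, S.supp i ⊆ A

theorem Refines.refl (S : Approx L cl) : Refines S S id id := ⟨fun _ h => h, fun _ h => h, by simp⟩

theorem Refines.trans {S T U : Approx L cl} {g g' : ℕ → ℕ} {e : S.Name → T.Name}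
    {e' : T.Name → U.Name} (h : Refines S T g e) (h' : Refines T U g' e') :
    Refines S U (g' ∘ g) (e' ∘ e) :=
  ⟨fun w hw => h.restrict _ (h'.restrict w hw), fun i hi => h'.free _ (h.free i hi), fun i => by
    simp [h'.supp, h.supp, Finset.image_image]⟩

/-- Shrinking the set of admissible assignments. -/
def shrink (S : Approx L cl) (R : Set (S.Name → M)) (hR : (∅ : Set M).Definable L R)
    (h : S.val ∈ R) : Approx L cl :=
  { S with
    P := S.P ∩ R
    definable := S.definable.inter hR
    val_mem := ⟨S.val_mem, h⟩
    spanned := fun w hw => S.spanned w hw.1 }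

theorem shrink_refines (S : Approx L cl) (R : Set (S.Name → M)) (hR : (∅ : Set M).Definable L R)
    (h : S.val ∈ R) : Refines S (S.shrink R hR h) id id :=
  ⟨fun _ hw => hw.1, fun _ h => h, fun i => by simp [shrink]⟩

/-- The approximation with a single free name. -/
def single (a : M) (ha : a ∉ cl ∅) : Approx L cl where
  Name := Unit
  finite := inferInstance
  val _ := a
  supp _ := {0}
  free := Set.univ
  P := Set.univ
  definable := Set.definable_univ
  val_mem := trivial
  independent i _ := by
    have : (Set.univ \ {i} : Set Unit) = ∅ := by ext; simp
    simpa [this] using ha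
  spanned w _ i := cl.le_closure _ ⟨i, by simp, rfl⟩

/-- The extension by a further name, bound or free. -/
theorem exists_witness (hcl : IsSufficientPregeometry L cl) (S : Approx L cl) {k : ℕ}
    (f : Fin k → S.Name) {Q : Set (Fin (k + 1) → M)} (hQ : (∅ : Set M).Definable L Q)
    (hy : ∃ y : M, (Fin.cons y (S.val ∘ f) : Fin (k + 1) → M) ∈ Q) :
    ∃ (T : Approx L cl) (e : S.Name → T.Name), Refines S T id e ∧
      (∀ A, S.SuppIn A → T.SuppIn A) ∧
      ∃ t, ∀ w ∈ T.P, (Fin.cons (w t) (w ∘ e ∘ f) : Fin (k + 1) → M) ∈ Q := by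
  classical
  obtain ⟨y, hy⟩ := hy
  let A : Finset ℕ := Finset.univ.biUnion fun j => S.supp (f j)
  have hfA : ∀ j, S.supp (f j) ⊆ A := fun j =>
    Finset.subset_biUnion_of_mem (fun j => S.supp (f j)) (Finset.mem_univ j)
  let supp' : Option S.Name → Finset ℕ := fun o => o.elim A S.supp
  have hbound : ∀ B, S.SuppIn B → ∀ o, supp' o ⊆ B := by
    rintro B hB (_ | i)
    · exact Finset.biUnion_subset.2 fun j _ => hB _
    · exact hB i
  let Q' : Set (Option S.Name → M) :=
    (fun w => w ∘ some) ⁻¹' S.P ∩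
      (fun w => w ∘ (Fin.cons none (some ∘ f) : Fin (k + 1) → Option S.Name)) ⁻¹' Q
  have hQ' : (∅ : Set M).Definable L Q' := (S.definable.preimage_comp _).inter (hQ.preimage_comp _)
  have hcons : ∀ w : Option S.Name → M, w ∘ (Fin.cons none (some ∘ f) : Fin (k + 1) → Option S.Name)
      = Fin.cons (w none) (w ∘ some ∘ f) := by
    intro w
    ext j
    refine Fin.cases ?_ (fun j => ?_) j <;> simp
  have hspan : ∀ w ∈ Q', ∀ (F : Set (Option S.Name)), some '' S.free ⊆ F → ∀ i : S.Name,
      w (some i) ∈ cl (w '' {j ∈ F | supp' j ⊆ supp' (some i)}) := by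
    intro w hw F hF i
    refine cl.monotone ?_ (S.spanned _ hw.1 i)
    rintro _ ⟨j, hj, rfl⟩
    exact ⟨some j, ⟨hF ⟨j, hj.1, rfl⟩, hj.2⟩, rfl⟩
  -- If `y` depends on the free names supported in `A`, the new name is bound: a closure formula
  -- witnessing this is added to `P`, so that the dependence holds under every admissible
  -- assignment. Otherwise the new name becomes free.
  by_cases hc : y ∈ cl (S.val '' {j ∈ S.free | S.supp j ⊆ A})
  · obtain ⟨n, b, χ, hb, hχ, hcf⟩ := hcl.formulaBased _ _ hc
    choose g hg hgb using hb
    obtain rfl : S.val ∘ g = b := funext hgb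
    let v' : Option S.Name → M := fun o => o.elim y S.val
    let C : Set (Option S.Name → M) :=
      (fun w => w ∘ (Fin.cons none (some ∘ g) : Fin (n + 1) → Option S.Name)) ⁻¹' Set.ofPred χ.Realize
    have hC : (∅ : Set M).Definable L C :=
      (Set.empty_definable_iff.2 ⟨χ, rfl⟩ : (∅ : Set M).Definable L (Set.ofPred χ.Realize)).preimage_comp _
    have hcons' : ∀ w : Option S.Name → M,
        w ∘ (Fin.cons none (some ∘ g) : Fin (n + 1) → Option S.Name)
        = Fin.cons (w none) (w ∘ some ∘ g) := by
      intro w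
      ext j
      refine Fin.cases ?_ (fun j => ?_) j <;> simp
    refine ⟨{ Name := Option S.Name
              finite := inferInstance
              val := v'
              supp := supp'
              free := some '' S.free
              P := Q' ∩ C
              definable := hQ'.inter hC
              val_mem := ⟨⟨S.val_mem, ?_⟩, ?_⟩
              independent := ?_
              spanned := ?_ }, some,
            ⟨fun w hw => hw.1.1, fun i hi => ⟨i, hi, rfl⟩, fun i => by simp [supp']⟩, hbound,
            none, fun w hw => ?_⟩
    · rw [Set.mem_preimage, hcons]
      exact hy
    · rw [Set.mem_preimage, hcons']
      exact hχ
    · rintro _ ⟨i, hi, rfl⟩ h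
      refine S.independent i hi (cl.monotone ?_ h)
      rintro _ ⟨_, ⟨⟨j, hj, rfl⟩, hji⟩, rfl⟩
      exact ⟨j, ⟨hj, fun h => hji (by rw [Set.mem_singleton_iff] at h ⊢; rw [h])⟩, rfl⟩
    · rintro w hw (_ | i)
      · have h := hw.2
        rw [Set.mem_preimage, hcons'] at h
        refine cl.monotone ?_ (hcf _ _ h)
        rintro _ ⟨m, rfl⟩
        exact ⟨some (g m), ⟨⟨g m, (hg m).1, rfl⟩, (hg m).2⟩, rfl⟩
      · exact hspan w hw.1 _ subset_rfl i
    · have h := hw.1.2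
      rwa [Set.mem_preimage, hcons] at h
  · have hy' : y ∉ cl (Set.range (S.val ∘ f)) := by
      intro h
      refine hc (cl.closure_min ?_ (cl.isClosed_closure _) h)
      rintro _ ⟨j, rfl⟩
      refine cl.monotone ?_ (S.spanned _ S.val_mem (f j))
      exact Set.image_mono fun i hi => ⟨hi.1, hi.2.trans (hfA j)⟩
    obtain ⟨φ, rfl⟩ := Set.empty_definable_iff.1 hQ
    -- `y` may still depend on free names outside `A`, so it is replaced by a witness outside the
    -- closure of all current values.
    obtain ⟨a, ha, haφ⟩ := hcl.weaklyHomogeneous k _ φ ⟨y, hy', hy⟩ _ (Set.finite_range S.val)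
    let v' : Option S.Name → M := fun o => o.elim a S.val
    refine ⟨{ Name := Option S.Name
              finite := inferInstance
              val := v'
              supp := supp'
              free := insert none (some '' S.free)
              P := Q'
              definable := hQ'
              val_mem := ⟨S.val_mem, ?_⟩
              independent := ?_
              spanned := ?_ }, some,
            ⟨fun w hw => hw.1, fun i hi => Or.inr ⟨i, hi, rfl⟩, fun i => by simp [supp']⟩, hbound,
            none, fun w hw => ?_⟩
    · rw [Set.mem_preimage, hcons]
      exact haφ
    · rintro _ (rfl | ⟨i, hi, rfl⟩) h
      · refine ha (cl.monotone ?_ h)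
        rintro _ ⟨_, ⟨rfl | ⟨j, hj, rfl⟩, hji⟩, rfl⟩
        · exact absurd rfl hji
        · exact ⟨j, rfl⟩
      · refine hcl.notMem_closure_insert (S.independent i hi) (c := a)
          (fun h => ha (cl.monotone ?_ h)) (cl.monotone ?_ h)
        · rintro _ (rfl | ⟨j, -, rfl⟩) <;> exact ⟨_, rfl⟩
        · rintro _ ⟨_, ⟨rfl | ⟨j, hj, rfl⟩, hji⟩, rfl⟩
          · exact Or.inl rfl
          · exact Or.inr ⟨j, ⟨hj, fun h => hji (by rw [Set.mem_singleton_iff] at h ⊢; rw [h])⟩, rfl⟩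
    · rintro w hw (_ | i)
      · exact cl.le_closure _ ⟨none, ⟨Or.inl rfl, subset_rfl⟩, rfl⟩
      · exact hspan w hw _ (fun _ h => Or.inr h) i
    · have h := hw.2
      rwa [Set.mem_preimage, hcons] at h

/-- The map of nodes sending `p` to `q`. -/
def moveNode (p q : ℕ) (x : ℕ) : ℕ := if x = p then q else x

/-- Splitting the node `p`: names with `p` in the support are doubled, and the copies are supported
on `q` instead of `p`. -/
theorem exists_split (hcl : IsSufficientPregeometry L cl) (S : Approx L cl) (p q : ℕ) :
    ∃ (T : Approx L cl) (c : Bool → S.Name → T.Name), Refines S T id (c false) ∧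
      Refines S T (moveNode p q) (c true) ∧
      (∀ A, S.SuppIn A → T.SuppIn (insert q A)) ∧
      ∀ i, p ∉ S.supp i → c true i = c false i := by
  classical
  -- Bound names resting on `p` are left out, as they may depend on the free names to be moved;
  -- projecting `P` quantifies them away. Names not resting on `p` are spanned by free names not
  -- resting on `p`, so they do not spoil the independence of `W`.
  let κ : Type := {i : S.Name // (i ∈ S.free ∧ p ∈ S.supp i) ∨ p ∉ S.supp i}
  have : Fintype κ := Fintype.ofFinite _
  let W : Finset κ := Finset.univ.filter fun i => i.1 ∈ S.free ∧ p ∈ S.supp i.1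
  have hWmem : ∀ i : κ, i ∈ W ↔ i.1 ∈ S.free ∧ p ∈ S.supp i.1 := by simp [W]
  have hW : ∀ i ∈ W, (S.val ∘ Subtype.val : κ → M) i ∉
      cl ((S.val ∘ Subtype.val : κ → M) '' {i}ᶜ) := by
    intro i hi h
    rw [hWmem] at hi
    refine S.independent i hi.1 (cl.closure_min ?_ (cl.isClosed_closure _) h)
    rintro _ ⟨j, hji, rfl⟩
    rcases j.2 with hj | hj
    · exact cl.le_closure _ ⟨j, ⟨hj.1, fun h => hji (Subtype.ext h)⟩, rfl⟩
    · refine cl.monotone ?_ (S.spanned _ S.val_mem j)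
      refine Set.image_mono fun m hm => ⟨hm.1, ?_⟩
      rintro rfl
      exact hj (hm.2 hi.2)
  obtain ⟨_, ⟨u, huP, rfl⟩, huoff, huW⟩ := hcl.exists_mem_independent
    (S.definable.image_comp (Subtype.val : κ → S.Name)) ⟨S.val, S.val_mem, rfl⟩ W hW
    (Set.finite_range S.val)
  have hu : ∀ i, p ∉ S.supp i → u i = S.val i := fun i hi =>
    huoff ⟨i, Or.inr hi⟩ fun h => hi ((hWmem _).1 h).2
  let c₁ : S.Name → S.Name ⊕ {i // p ∈ S.supp i} := fun i =>
    if h : p ∈ S.supp i then Sum.inr ⟨i, h⟩ else Sum.inl i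
  have hc₁ : ∀ i (h : p ∈ S.supp i), c₁ i = Sum.inr ⟨i, h⟩ := fun i h => dif_pos h
  have hc₁' : ∀ i, p ∉ S.supp i → c₁ i = Sum.inl i := fun i h => dif_neg h
  let v' : S.Name ⊕ {i // p ∈ S.supp i} → M := Sum.elim S.val fun i => u i
  have hv' : v' ∘ c₁ = u := by
    ext i
    by_cases h : p ∈ S.supp i
    · simp [hc₁ i h, v']
    · simp [hc₁' i h, v', hu i h]
  let supp' : S.Name ⊕ {i // p ∈ S.supp i} → Finset ℕ :=
    Sum.elim S.supp fun i => (S.supp i).image (moveNode p q)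
  have hs' : ∀ i, supp' (c₁ i) = (S.supp i).image (moveNode p q) := by
    intro i
    by_cases h : p ∈ S.supp i
    · simp [hc₁ i h, supp']
    · simp only [hc₁' i h, supp', Sum.elim_inl]
      conv_lhs => rw [← Finset.image_id (s := S.supp i)]
      refine Finset.image_congr fun x hx => ?_
      rw [moveNode, if_neg (by rintro rfl; exact h hx), id]
  let F : Set (S.Name ⊕ {i // p ∈ S.supp i}) := Sum.inl '' S.free ∪ c₁ '' S.free
  have hF : ∀ o ∈ F, (∃ i ∈ S.free, o = Sum.inl i) ∨
      ∃ i ∈ S.free, ∃ h : p ∈ S.supp i, o = Sum.inr ⟨i, h⟩ := by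
    rintro _ (⟨i, hi, rfl⟩ | ⟨i, hi, rfl⟩)
    · exact Or.inl ⟨i, hi, rfl⟩
    · by_cases h : p ∈ S.supp i
      · exact Or.inr ⟨i, hi, h, hc₁ i h⟩
      · exact Or.inl ⟨i, hi, hc₁' i h⟩
  refine ⟨{ Name := S.Name ⊕ {i // p ∈ S.supp i}
            finite := inferInstance
            val := v'
            supp := supp'
            free := F
            P := (fun w => w ∘ Sum.inl) ⁻¹' S.P ∩ (fun w => w ∘ c₁) ⁻¹' S.P
            definable := (S.definable.preimage_comp _).inter (S.definable.preimage_comp _)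
            val_mem := ⟨S.val_mem, by rwa [Set.mem_preimage, hv']⟩
            independent := ?_
            spanned := ?_ }, fun b => if b then c₁ else Sum.inl,
          ⟨fun w hw => hw.1, fun i hi => Or.inl ⟨i, hi, rfl⟩, fun i => by simp [supp']⟩,
          ⟨fun w hw => hw.2, fun i hi => Or.inr ⟨i, hi, rfl⟩, hs'⟩, ?_, fun i hi => by
            simpa using hc₁' i hi⟩
  · intro o ho
    rcases hF o ho with ⟨i, hi, rfl⟩ | ⟨i, hi, h, rfl⟩
    -- An old free name is independent of the other old ones, and the copies are independent over
    -- all old values; exchange combines the two.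
    · have := hcl.notMem_closure_union_image (S.independent i hi) (u ∘ Subtype.val : κ → M) W
        (fun j hj h => huW j hj (cl.monotone ?_ h))
      · refine fun h => this (cl.monotone ?_ h)
        rintro _ ⟨o', ⟨ho', hne⟩, rfl⟩
        rcases hF o' ho' with ⟨j, hj, rfl⟩ | ⟨j, hj, hp, rfl⟩
        · exact Or.inl ⟨j, ⟨hj, fun h => hne (congrArg Sum.inl h)⟩, rfl⟩
        · exact Or.inr ⟨⟨j, Or.inl ⟨hj, hp⟩⟩, Finset.mem_coe.2 ((hWmem _).2 ⟨hj, hp⟩), rfl⟩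
      · rintro _ (rfl | ⟨m, -, rfl⟩ | ⟨m, hm, rfl⟩)
        · exact Or.inl ⟨i, rfl⟩
        · exact Or.inl ⟨m, rfl⟩
        · exact Or.inr ⟨m, hm.2, rfl⟩
    · intro hmem
      refine huW ⟨i, Or.inl ⟨hi, h⟩⟩ ((hWmem _).2 ⟨hi, h⟩) (cl.monotone ?_ hmem)
      rintro _ ⟨o', ⟨ho', hne⟩, rfl⟩
      rcases hF o' ho' with ⟨j, hj, rfl⟩ | ⟨j, hj, hp, rfl⟩
      · exact Or.inl ⟨j, rfl⟩
      · refine Or.inr ⟨⟨j, Or.inl ⟨hj, hp⟩⟩, fun h => hne ?_, rfl⟩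
        obtain rfl : j = i := congrArg Subtype.val h
        rfl
  · have h₁ : ∀ w : S.Name ⊕ {i // p ∈ S.supp i} → M, w ∘ c₁ ∈ S.P → ∀ i,
        w (c₁ i) ∈ cl (w '' {j ∈ F | supp' j ⊆ supp' (c₁ i)}) := by
      intro w hw i
      refine cl.monotone ?_ (S.spanned _ hw i)
      rintro _ ⟨j, hj, rfl⟩
      exact ⟨c₁ j, ⟨Or.inr ⟨j, hj.1, rfl⟩, by
        rw [hs', hs']
        exact Finset.image_subset_image hj.2⟩, rfl⟩
    rintro w hw (i | ⟨i, h⟩)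
    · refine cl.monotone ?_ (S.spanned _ hw.1 i)
      rintro _ ⟨j, hj, rfl⟩
      exact ⟨Sum.inl j, ⟨Or.inl ⟨j, hj.1, rfl⟩, hj.2⟩, rfl⟩
    · simpa only [hc₁ i h] using h₁ w hw.2 i
  · rintro A hA (i | ⟨i, h⟩)
    · exact (hA i).trans (Finset.subset_insert _ _)
    · refine Finset.image_subset_iff.2 fun x hx => ?_
      rw [moveNode]
      split_ifs
      · exact Finset.mem_insert_self _ _
      · exact Finset.mem_insert_of_mem (hA i hx)

end Approx

namespace Approx

variable {L : FirstOrder.Language.{u, v}} {M : Type w} [L.Structure M]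
  {cl : ClosureOperator (Set M)}

/-- For each of the finitely many tuples of names, a member of the cover containing its current
value is imposed as a condition on `P`. -/
theorem exists_shrink (S : Approx L cl) (n : ℕ) {k : ℕ → ℕ} (D : ∀ j, Set (Set (Fin (k j) → M)))
    (hdef : ∀ j, ∀ d ∈ D j, (∅ : Set M).Definable L d) (hcover : ∀ j x, ∃ d ∈ D j, x ∈ d) :
    ∃ (T : Approx L cl) (e : S.Name → T.Name), Refines S T id e ∧
      (∀ A, S.SuppIn A → T.SuppIn A) ∧
      ∀ j < n, ∀ f : Fin (k j) → T.Name, ∃ d ∈ D j, ∀ w ∈ T.P, w ∘ f ∈ d := by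
  choose d hd hmem using hcover
  let R : (Σ j : Fin n, (Fin (k j) → S.Name)) → Set (S.Name → M) := fun t =>
    (fun w => w ∘ t.2) ⁻¹' d t.1 (S.val ∘ t.2)
  refine ⟨S.shrink (⋂ t, R t) (Set.definable_iInter_of_finite fun t =>
    (hdef _ _ (hd _ _)).preimage_comp _) (Set.mem_iInter.2 fun t => hmem _ _), id,
    S.shrink_refines _ _ _, fun A hA => hA, fun j hj f => ⟨_, hd j (S.val ∘ f), fun w hw => ?_⟩⟩
  exact Set.mem_iInter.1 hw.2 ⟨⟨j, hj⟩, f⟩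

theorem exists_witnesses (hcl : IsSufficientPregeometry L cl) {k : ℕ → ℕ}
    (Q : ∀ j, Set (Fin (k j + 1) → M)) (hdef : ∀ j, (∅ : Set M).Definable L (Q j))
    (hex : ∀ j (x : Fin (k j) → M), ∃ y : M, (Fin.cons y x : Fin (k j + 1) → M) ∈ Q j)
    (S : Approx L cl) (l : List (Σ j : ℕ, (Fin (k j) → S.Name))) :
    ∃ (T : Approx L cl) (e : S.Name → T.Name), Refines S T id e ∧
      (∀ A, S.SuppIn A → T.SuppIn A) ∧
      ∀ τ ∈ l, ∃ t, ∀ w ∈ T.P, (Fin.cons (w t) (w ∘ e ∘ τ.2) : Fin (k τ.1 + 1) → M) ∈ Q τ.1 := by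
  induction l with
  | nil => exact ⟨S, id, Refines.refl S, fun _ h => h, by simp⟩
  | cons τ l ih =>
    obtain ⟨T, e, he, hA, hl⟩ := ih
    obtain ⟨U, e', he', hA', t, ht⟩ := T.exists_witness hcl (e ∘ τ.2) (hdef τ.1) (hex _ _)
    refine ⟨U, e' ∘ e, he.trans he', fun A h => hA' A (hA A h), fun σ hσ => ?_⟩
    rcases List.mem_cons.1 hσ with rfl | hσ
    · exact ⟨t, fun w hw => ht w hw⟩
    · obtain ⟨t, ht⟩ := hl σ hσ
      exact ⟨e' t, fun w hw => ht _ (he'.restrict w hw)⟩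

/-- One step of the construction: split a node, add witnesses and shrink. -/
theorem exists_next (hcl : IsSufficientPregeometry L cl) {k : ℕ → ℕ}
    (Q : ∀ j, Set (Fin (k j + 1) → M)) (hQ : ∀ j, (∅ : Set M).Definable L (Q j))
    (hex : ∀ j (x : Fin (k j) → M), ∃ y : M, (Fin.cons y x : Fin (k j + 1) → M) ∈ Q j)
    {m : ℕ → ℕ} (D : ∀ j, Set (Set (Fin (m j) → M)))
    (hD : ∀ j, ∀ d ∈ D j, (∅ : Set M).Definable L d) (hcover : ∀ j x, ∃ d ∈ D j, x ∈ d)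
    (S : Approx L cl) (p q n : ℕ) :
    ∃ (T : Approx L cl) (c : Bool → S.Name → T.Name), Refines S T id (c false) ∧
      Refines S T (moveNode p q) (c true) ∧
      (∀ A, S.SuppIn A → T.SuppIn (insert q A)) ∧
      (∀ i, p ∉ S.supp i → c true i = c false i) ∧
      (∀ j < n, ∀ (b : Bool) (f : Fin (k j) → S.Name), ∃ t, ∀ w ∈ T.P,
        (Fin.cons (w t) (w ∘ c b ∘ f) : Fin (k j + 1) → M) ∈ Q j) ∧
      ∀ j < n, ∀ f : Fin (m j) → T.Name, ∃ d ∈ D j, ∀ w ∈ T.P, w ∘ f ∈ d := by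
  obtain ⟨S₁, c, hc, hc', hA₁, hagree⟩ := S.exists_split hcl p q
  have : Fintype (Σ j : Fin n, (Bool × (Fin (k j) → S.Name))) := Fintype.ofFinite _
  let task : (Σ j : Fin n, (Bool × (Fin (k j) → S.Name))) → Σ j : ℕ, (Fin (k j) → S₁.Name) :=
    fun τ => ⟨τ.1, c τ.2.1 ∘ τ.2.2⟩
  obtain ⟨S₂, e, he, hA₂, hw⟩ := exists_witnesses hcl Q hQ hex S₁ (Finset.univ.toList.map task)
  obtain ⟨S₃, e', he', hA₃, hs⟩ := S₂.exists_shrink n D hD hcover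
  refine ⟨S₃, fun b => e' ∘ e ∘ c b, (hc.trans he).trans he', (hc'.trans he).trans he',
    fun A h => hA₃ _ (hA₂ _ (hA₁ _ h)), fun i hi => by simp [hagree i hi], fun j hj b f => ?_, hs⟩
  obtain ⟨t, ht⟩ := hw ⟨j, c b ∘ f⟩ (List.mem_map.2 ⟨⟨⟨j, hj⟩, b, f⟩, by simp, rfl⟩)
  exact ⟨e' t, fun w hw => ht _ (he'.restrict w hw)⟩

end Approx

/-! ### The splitting schedule and the tower of approximations -/

/-- The node that is split at step `s`; the new node is `s + 1`. -/
def splitNode (s : ℕ) : ℕ := s + 1 - 2 ^ Nat.log 2 (s + 1)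

theorem splitNode_lt (s : ℕ) : splitNode s < s + 1 :=
  Nat.sub_lt (Nat.succ_pos s) (by positivity)

/-- The effect on nodes of the two maps from step `s` to step `s + 1`. -/
def nodeStep (s : ℕ) (b : Bool) (x : ℕ) : ℕ := if b = true ∧ x = splitNode s then s + 1 else x

/-- A sequence of approximations in which step `s` splits the node `splitNode s`. -/
structure Tower (L : FirstOrder.Language.{u, v}) {M : Type w} [L.Structure M]
    (cl : ClosureOperator (Set M)) where
  S : ℕ → Approx L cl
  c : ∀ s, Bool → (S s).Name → (S (s + 1)).Name
  refines : ∀ s b, Approx.Refines (S s) (S (s + 1)) (nodeStep s b) (c s b)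
  suppIn : ∀ s, (S s).SuppIn (Finset.range (s + 1))
  agree : ∀ s i, splitNode s ∉ (S s).supp i → c s true i = c s false i
  root : (S 0).Name
  root_free : root ∈ (S 0).free
  root_supp : (S 0).supp root = {0}

theorem Tower.exists_tower {L : FirstOrder.Language.{u, v}} {M : Type w} [L.Structure M]
    {cl : ClosureOperator (Set M)} (hcl : IsSufficientPregeometry L cl) {k : ℕ → ℕ}
    (Q : ∀ j, Set (Fin (k j + 1) → M)) (hQ : ∀ j, (∅ : Set M).Definable L (Q j))
    (hex : ∀ j (x : Fin (k j) → M), ∃ y : M, (Fin.cons y x : Fin (k j + 1) → M) ∈ Q j)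
    {m : ℕ → ℕ} (D : ∀ j, Set (Set (Fin (m j) → M)))
    (hD : ∀ j, ∀ d ∈ D j, (∅ : Set M).Definable L d) (hcover : ∀ j x, ∃ d ∈ D j, x ∈ d) :
    ∃ T : Tower L cl,
      (∀ s, ∀ j < s, ∀ (b : Bool) (f : Fin (k j) → (T.S s).Name), ∃ t, ∀ w ∈ (T.S (s + 1)).P,
        (Fin.cons (w t) (w ∘ T.c s b ∘ f) : Fin (k j + 1) → M) ∈ Q j) ∧
      ∀ s, ∀ j < s, ∀ f : Fin (m j) → (T.S s).Name, ∃ d ∈ D j, ∀ w ∈ (T.S s).P, w ∘ f ∈ d := by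
  obtain ⟨a, ha⟩ := hcl.extendible
  choose next c h₁ h₂ h₃ h₄ h₅ h₆ using fun (S : Approx L cl) (s : ℕ) =>
    S.exists_next hcl Q hQ hex D hD hcover (splitNode s) (s + 1) (s + 1)
  let S : ℕ → Approx L cl := fun s => Nat.rec (Approx.single a ha) (fun s X => next X s) s
  refine ⟨{ S := S
            c := fun s => c (S s) s
            refines := ?_
            suppIn := ?_
            agree := fun s i hi => h₄ _ _ i hi
            root := ()
            root_free := trivial
            root_supp := rfl }, fun s j hj b f => h₅ (S s) s j (hj.trans s.lt_succ_self) b f, ?_⟩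
  · rintro s (_ | _)
    · convert! h₁ (S s) s using 1
    · convert! h₂ (S s) s using 1
      funext x
      simp [nodeStep, Approx.moveNode]
  · intro s
    induction s with
    | zero => exact fun i => by simp [S, Approx.single]
    | succ s ih =>
      rw [Finset.range_add_one]
      exact h₃ _ _ _ ih
  · rintro (_ | s) j hj
    · exact absurd hj (Nat.not_lt_zero j)
    · exact h₆ (S s) s j hj

/-! ### Points of the tower and their stabilization -/

open Filter

namespace Tower

variable {L : FirstOrder.Language.{u, v}} {M : Type w} [L.Structure M]
  {cl : ClosureOperator (Set M)} (T : Tower L cl)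

/-- The path of a name through the tower, following the choices `b`. -/
def thread (b : ℕ → Bool) {s₀ : ℕ} (i : (T.S s₀).Name) {s : ℕ} (h : s₀ ≤ s) : (T.S s).Name :=
  Nat.leRec (motive := fun m _ => (T.S m).Name) i (fun m _ x => T.c m (b m) x) h

@[simp]
theorem thread_self (b : ℕ → Bool) {s₀ : ℕ} (i : (T.S s₀).Name) : T.thread b i le_rfl = i :=
  Nat.leRec_self _ _

theorem thread_succ (b : ℕ → Bool) {s₀ : ℕ} (i : (T.S s₀).Name) {s : ℕ} (h : s₀ ≤ s)
    (h' : s₀ ≤ s + 1) : T.thread b i h' = T.c s (b s) (T.thread b i h) :=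
  Nat.leRec_succ _ _ h

theorem thread_restrict (b : ℕ → Bool) {s₀ s : ℕ} (h : s₀ ≤ s) {w : (T.S s).Name → M}
    (hw : w ∈ (T.S s).P) : (fun i => w (T.thread b i h)) ∈ (T.S s₀).P := by
  induction s, h using Nat.le_induction with
  | base => simpa using hw
  | succ s h ih => simpa only [thread_succ T b _ h, Function.comp_apply] using ih ((T.refines s (b s)).restrict w hw)

/-- Points of the presentation: a name at some step, and a path through the later steps. -/
abbrev Point : Type := (Σ s, (T.S s).Name) × (ℕ → Bool)

variable {T}

/-- The name of a point at step `s` (a default name before the point is born). -/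
def name (x : T.Point) (s : ℕ) : (T.S s).Name :=
  if h : x.1.1 ≤ s then T.thread x.2 x.1.2 h else T.thread x.2 T.root s.zero_le

theorem name_mk (s₀ : ℕ) (i : (T.S s₀).Name) (b : ℕ → Bool) {s : ℕ} (h : s₀ ≤ s) :
    name ((⟨s₀, i⟩, b) : T.Point) s = T.thread b i h := dif_pos h

theorem name_succ (x : T.Point) {s : ℕ} (h : x.1.1 ≤ s) :
    name x (s + 1) = T.c s (x.2 s) (name x s) := by
  rw [name, name, dif_pos h, dif_pos (h.trans s.le_succ), thread_succ T _ _ h]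

/-- The value of a point at step `s`. -/
def value (x : T.Point) (s : ℕ) : M := (T.S s).val (name x s)

theorem supp_name_succ (x : T.Point) {s : ℕ} (h : x.1.1 ≤ s) :
    (T.S (s + 1)).supp (name x (s + 1)) = ((T.S s).supp (name x s)).image (nodeStep s (x.2 s)) := by
  rw [name_succ x h, (T.refines s (x.2 s)).supp]

theorem card_supp_name_le (x : T.Point) {s : ℕ} (h : x.1.1 ≤ s) :
    ((T.S s).supp (name x s)).card ≤ ((T.S x.1.1).supp x.1.2).card := by
  induction s, h using Nat.le_induction with
  | base => rw [name, dif_pos le_rfl, thread_self]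
  | succ s h ih =>
    rw [supp_name_succ x h]
    exact Finset.card_image_le.trans ih

/-- The predecessor at step `s` of a node at step `s + 1`. -/
def nodePred (s x : ℕ) : ℕ := if x = s + 1 then splitNode s else x

theorem nodePred_nodeStep {s x : ℕ} (hx : x < s + 1) (b : Bool) :
    nodePred s (nodeStep s b x) = x := by
  unfold nodePred nodeStep
  split_ifs with h₁ h₂ h₂
  · exact h₁.2.symm
  · exact absurd rfl h₂
  · omega
  · rfl

section Stability

variable {ι : Type*} [Fintype ι]

/-- The nodes occurring in the supports of the names of a finite family of points. -/
def nodes (x : ι → T.Point) (s : ℕ) : Finset ℕ :=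
  Finset.univ.biUnion fun j => (T.S s).supp (name (x j) s)

theorem supp_subset_nodes (x : ι → T.Point) (s : ℕ) (j : ι) :
    (T.S s).supp (name (x j) s) ⊆ nodes x s :=
  Finset.subset_biUnion_of_mem (fun j => (T.S s).supp (name (x j) s)) (Finset.mem_univ j)

/-- Whichever copy is followed, each node has its origin as predecessor. Hence the number of
occupied nodes cannot decrease. -/
theorem image_nodePred_nodes {x : ι → T.Point} {s : ℕ} (h : ∀ j, (x j).1.1 ≤ s) :
    (nodes x (s + 1)).image (nodePred s) = nodes x s := by
  rw [nodes, nodes, Finset.biUnion_image]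
  refine Finset.biUnion_congr rfl fun j _ => ?_
  rw [supp_name_succ _ (h j), Finset.image_image]
  conv_rhs => rw [← Finset.image_id (s := (T.S s).supp _)]
  refine Finset.image_congr fun a ha => ?_
  exact nodePred_nodeStep (Finset.mem_range.1 (T.suppIn s _ ha)) _

theorem card_nodes_le_succ {x : ι → T.Point} {s : ℕ} (h : ∀ j, (x j).1.1 ≤ s) :
    (nodes x s).card ≤ (nodes x (s + 1)).card := by
  rw [← image_nodePred_nodes h]
  exact Finset.card_image_le

/-- As long as no new nodes appear, all points of a finite family can be taken to follow the same
choices. -/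
theorem exists_uniform_step {x : ι → T.Point} {s : ℕ} (h : ∀ j, (x j).1.1 ≤ s)
    (hcard : (nodes x (s + 1)).card ≤ (nodes x s).card) :
    ∃ b, ∀ j, name (x j) (s + 1) = T.c s b (name (x j) s) := by
  have hinj : Set.InjOn (nodePred s) (nodes x (s + 1)) := by
    rw [← Finset.card_image_iff, image_nodePred_nodes h]
    exact (card_nodes_le_succ h).antisymm hcard
  -- By injectivity of `nodePred s`, the nodes `splitNode s` and `s + 1` are not both occupied, so
  -- all points resting on the split node go the same way. For the other points the two copy maps
  -- agree.
  refine ⟨decide (s + 1 ∈ nodes x (s + 1)), fun j => ?_⟩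
  rw [name_succ _ (h j)]
  by_cases hp : splitNode s ∈ (T.S s).supp (name (x j) s)
  · have hmem : nodeStep s ((x j).2 s) (splitNode s) ∈ nodes x (s + 1) := by
      refine supp_subset_nodes x _ j ?_
      rw [supp_name_succ _ (h j)]
      exact Finset.mem_image_of_mem _ hp
    congr 1
    cases hb : (x j).2 s
    · rw [hb, nodeStep, if_neg (by simp)] at hmem
      symm
      rw [decide_eq_false_iff_not]
      intro hs
      have := hinj hmem hs (by simp [nodePred])
      exact (splitNode_lt s).ne this
    · rw [hb, nodeStep, if_pos (by simp)] at hmem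
      simpa using hmem
  · have := T.agree s _ hp
    cases (x j).2 s <;> cases decide (s + 1 ∈ nodes x (s + 1)) <;> simp [this]

/-- From step `s` on, all points of the family exist and follow the choices `β`. -/
def StableFrom (x : ι → T.Point) (s : ℕ) (β : ℕ → Bool) : Prop :=
  (∀ j, (x j).1.1 ≤ s) ∧
    ∀ s' ≥ s, ∀ j, name (x j) (s' + 1) = T.c s' (β s') (name (x j) s')

theorem exists_stableFrom_of_card_le {x : ι → T.Point} {s : ℕ} (h : ∀ j, (x j).1.1 ≤ s)
    (hcard : ∀ s' ≥ s, (nodes x s').card ≤ (nodes x s).card) : ∃ β, StableFrom x s β := by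
  have hmono : ∀ s' ≥ s, (nodes x s).card ≤ (nodes x s').card := by
    intro s' hs'
    induction s', hs' using Nat.le_induction with
    | base => rfl
    | succ s' hs' ih => exact ih.trans (card_nodes_le_succ fun j => (h j).trans hs')
  have : ∀ s', ∃ b, s ≤ s' → ∀ j, name (x j) (s' + 1) = T.c s' b (name (x j) s') := by
    intro s'
    by_cases hs' : s ≤ s'
    · obtain ⟨b, hb⟩ := exists_uniform_step (fun j => (h j).trans hs')
        ((hcard (s' + 1) (Nat.le_succ_of_le hs')).trans (hmono s' hs'))
      exact ⟨b, fun _ => hb⟩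
    · exact ⟨true, fun h => absurd h hs'⟩
  choose β hβ using this
  exact ⟨β, h, hβ⟩

theorem exists_stableFrom (x : ι → T.Point) : ∃ s β, StableFrom x s β := by
  let s₀ := Finset.univ.sup fun j => (x j).1.1
  have h₀ : ∀ j, (x j).1.1 ≤ s₀ := fun j => Finset.le_sup (f := fun j => (x j).1.1) (Finset.mem_univ j)
  let B := ∑ j, ((T.S (x j).1.1).supp (x j).1.2).card
  have hB : ∀ s ≥ s₀, (nodes x s).card ≤ B := fun s hs =>
    Finset.card_biUnion_le.trans (Finset.sum_le_sum fun j _ => card_supp_name_le _ ((h₀ j).trans hs))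
  -- Minimizing `f` selects a step at which the bounded number of nodes is largest.
  let f : ℕ → ℕ := fun n => B - (nodes x (s₀ + n)).card
  obtain ⟨n, hn⟩ : ∃ n, ∀ m, f n ≤ f m := ⟨Function.argmin f, fun m => Function.argmin_le f m⟩
  obtain ⟨β, hβ⟩ := exists_stableFrom_of_card_le (x := x) (s := s₀ + n)
    (fun j => (h₀ j).trans (Nat.le_add_right _ _)) (fun s' hs' => by
      obtain ⟨m, rfl⟩ := Nat.exists_eq_add_of_le ((Nat.le_add_right s₀ n).trans hs')
      have h₁ := hn m
      have h₂ := hB (s₀ + m) (Nat.le_add_right _ _)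
      have h₃ := hB (s₀ + n) (Nat.le_add_right _ _)
      simp only [f] at h₁
      omega)
  exact ⟨_, β, hβ⟩

end Stability

theorem StableFrom.mono {ι : Type*} {x : ι → T.Point} {s s' : ℕ} {β : ℕ → Bool} (h : StableFrom x s β)
    (hs : s ≤ s') : StableFrom x s' β :=
  ⟨fun j => (h.1 j).trans hs, fun t ht => h.2 t (hs.trans ht)⟩

theorem StableFrom.name_eq {ι : Type*} {x : ι → T.Point} {s s' : ℕ} {β : ℕ → Bool} (h : StableFrom x s β)
    (hs : s ≤ s') (j : ι) : name (x j) s' = T.thread β (name (x j) s) hs := by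
  induction s', hs using Nat.le_induction with
  | base => simp
  | succ s' hs ih => rw [h.2 s' hs, ih, thread_succ T β _ hs]

/-- Properties ensured by the admissible assignments persist. -/
theorem StableFrom.value_mem {ι : Type*} {x : ι → T.Point} {s s' : ℕ} {β : ℕ → Bool} (h : StableFrom x s β)
    (hs : s ≤ s') {d : Set (ι → M)} (hd : ∀ w ∈ (T.S s).P, (fun j => w (name (x j) s)) ∈ d) :
    (fun j => value (x j) s') ∈ d := by
  simpa only [value, h.name_eq hs] using hd _ (T.thread_restrict β hs (T.S s').val_mem)

variable (T) in
/-- A tower in which every formula is eventually decided and eventually witnessed. -/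
structure IsRich : Prop where
  decides : ∀ (k : ℕ) (φ : L.Formula (Fin k)), ∃ s₀, ∀ s ≥ s₀, ∀ f : Fin k → (T.S s).Name,
    (∀ w ∈ (T.S s).P, φ.Realize (w ∘ f)) ∨ ∀ w ∈ (T.S s).P, ¬ φ.Realize (w ∘ f)
  witnesses : ∀ (k : ℕ) (φ : L.Formula (Fin (k + 1))), ∃ s₀, ∀ s ≥ s₀, ∀ (b : Bool)
    (f : Fin k → (T.S s).Name), ∃ t, ∀ w ∈ (T.S (s + 1)).P, ∀ y : M,
      φ.Realize (Fin.cons y (w ∘ T.c s b ∘ f) : Fin (k + 1) → M) →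
        φ.Realize (Fin.cons (w t) (w ∘ T.c s b ∘ f) : Fin (k + 1) → M)

/-- At a late stable step, `P` decides `φ` for the names of the tuple, and stability carries the
decision to all later values. -/
theorem IsRich.eventually_or (hT : T.IsRich) {k : ℕ} (φ : L.Formula (Fin k)) (x : Fin k → T.Point) :
    (∀ᶠ s in atTop, φ.Realize fun j => value (x j) s) ∨
      ∀ᶠ s in atTop, ¬ φ.Realize fun j => value (x j) s := by
  obtain ⟨s₀, h₀⟩ := hT.decides k φ
  obtain ⟨s₁, β, h₁⟩ := exists_stableFrom x
  have h₁ := h₁.mono (le_max_right s₀ s₁)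
  refine (h₀ _ (le_max_left s₀ s₁) fun j => name (x j) _).imp (fun h => ?_) (fun h => ?_)
  · exact eventually_atTop.2 ⟨_, fun s hs => h₁.value_mem hs (d := {w | φ.Realize w}) h⟩
  · exact eventually_atTop.2 ⟨_, fun s hs => h₁.value_mem hs (d := {w | ¬ φ.Realize w}) h⟩

theorem IsRich.eventually_hyperfilter (hT : T.IsRich) {k : ℕ} (φ : L.Formula (Fin k))
    (x : Fin k → T.Point) :
    (∀ᶠ s in hyperfilter ℕ, φ.Realize fun j => value (x j) s) ↔
      ∀ᶠ s in atTop, φ.Realize fun j => value (x j) s := by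
  refine ⟨fun h => (hT.eventually_or φ x).resolve_right fun h' => ?_,
    fun h => h.filter_mono Nat.hyperfilter_le_atTop⟩
  obtain ⟨s, h₁, h₂⟩ := (h.and (h'.filter_mono Nat.hyperfilter_le_atTop)).exists
  exact h₂ h₁

theorem IsRich.exists_witness (hT : T.IsRich) {k : ℕ} (φ : L.Formula (Fin (k + 1)))
    (x : Fin k → T.Point) : ∃ z : T.Point, ∀ᶠ s in atTop, ∀ y : M,
      φ.Realize (Fin.cons y fun j => value (x j) s : Fin (k + 1) → M) →
        φ.Realize (Fin.cons (value z s) fun j => value (x j) s : Fin (k + 1) → M) := by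
  obtain ⟨s₀, h₀⟩ := hT.witnesses k φ
  obtain ⟨s₁, β, h₁⟩ := exists_stableFrom x
  have h₁ := h₁.mono (le_max_right s₀ s₁)
  set s := max s₀ s₁
  obtain ⟨t, ht⟩ := h₀ s (le_max_left s₀ s₁) (β s) fun j => name (x j) s
  -- The witness is born at step `s + 1` and follows the common choices `β`, so it moves together
  -- with the tuple.
  refine ⟨(⟨s + 1, t⟩, β), eventually_atTop.2 ⟨s + 1, fun s' hs' y hy => ?_⟩⟩
  have h₂ := h₁.mono s.le_succ
  have hx : ∀ j, value (x j) s' =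
      (T.S s').val (T.thread β (T.c s (β s) (name (x j) s)) hs') := by
    intro j
    rw [value, h₂.name_eq hs', h₁.2 s le_rfl]
  have hz : value ((⟨s + 1, t⟩, β) : T.Point) s' = (T.S s').val (T.thread β t hs') := by
    rw [value, name_mk _ _ _ hs']
  simp only [hx] at hy
  simp only [hx, hz]
  exact ht _ (T.thread_restrict β hs' (T.S s').val_mem) y hy

end Tower

/-! ### Discrete measurable structure on names -/

instance Approx.instMeasurableSpaceName {L : FirstOrder.Language.{u, v}} {M : Type w} [L.Structure M]
    {cl : ClosureOperator (Set M)} (S : Approx L cl) : MeasurableSpace S.Name := ⊤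

instance Approx.instDiscreteMeasurableSpaceName {L : FirstOrder.Language.{u, v}} {M : Type w}
    [L.Structure M] {cl : ClosureOperator (Set M)} (S : Approx L cl) :
    DiscreteMeasurableSpace S.Name := ⟨fun _ => trivial⟩

instance Tower.instDiscreteMeasurableSpaceSigmaName {L : FirstOrder.Language.{u, v}} {M : Type w}
    [L.Structure M] {cl : ClosureOperator (Set M)} (T : Tower L cl) :
    DiscreteMeasurableSpace (Σ s, (T.S s).Name) :=
  ⟨fun _ => MeasurableSpace.measurableSet_iInf.2 fun _ => trivial⟩

namespace Tower

variable {L : FirstOrder.Language.{u, v}} {M : Type w} [L.Structure M]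
  {cl : ClosureOperator (Set M)} {T : Tower L cl}

/-! ### The model -/

variable (T) in
/-- `mk` presents `N` as the limit of the tower: a formula holds in `N` of some points if and only
if it holds of their values in `M` from some step on. -/
structure IsLimit {N : Type} [L.Structure N] (mk : T.Point → N) : Prop where
  surjective : Function.Surjective mk
  realize_iff : ∀ (k : ℕ) (φ : L.Formula (Fin k)) (x : Fin k → T.Point),
    (φ.Realize fun j => mk (x j)) ↔ ∀ᶠ s in atTop, φ.Realize fun j => value (x j) s
  equivalent : L.ElementarilyEquivalent M N

-- The value sequences of points form an elementary substructure of an ultrapower of `M`, by the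
-- Tarski–Vaught test. Since truth values converge, the ultrafilter may be replaced by "from some
-- step on".
open FirstOrder.Language in
theorem IsRich.exists_isLimit (hT : T.IsRich) :
    ∃ (N : Type) (_ : L.Structure N) (mk : T.Point → N), T.IsLimit mk := by
  have : Nonempty M := ⟨(T.S 0).val T.root⟩
  let Prd := (hyperfilter ℕ : Filter ℕ).Product fun _ => M
  let toPrd : (ℕ → M) → Prd :=
    @Quotient.mk' _ ((hyperfilter ℕ : Filter ℕ).productSetoid fun _ => M)
  let el : T.Point → Prd := fun x => toPrd (value x)
  have hel : ∀ {α : Type} (φ : L.Formula α) (x : α → T.Point), (φ.Realize fun j => el (x j)) ↔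
      ∀ᶠ s in hyperfilter ℕ, φ.Realize fun j => value (x j) s := fun φ x =>
    Ultraproduct.realize_formula_cast (u := hyperfilter ℕ) φ fun j => value (x j)
  have hwit : ∀ {k : ℕ} (φ : L.Formula (Fin (k + 1))) (x : Fin k → T.Point) (a : Prd),
      φ.Realize (Fin.cons a fun j => el (x j) : Fin (k + 1) → Prd) →
      ∃ z, φ.Realize (Fin.cons (el z) fun j => el (x j) : Fin (k + 1) → Prd) := by
    intro k φ x a ha
    obtain ⟨a, rfl⟩ := Quotient.exists_rep a
    have hcons : ∀ a : ℕ → M, φ.Realize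
        (Fin.cons (toPrd a) fun j => el (x j) : Fin (k + 1) → Prd) ↔
        ∀ᶠ s in hyperfilter ℕ,
          φ.Realize (Fin.cons (a s) fun j => value (x j) s : Fin (k + 1) → M) := by
      intro a
      have h₁ : (Fin.cons (toPrd a) fun j => el (x j) : Fin (k + 1) → Prd) = fun i =>
          toPrd ((Fin.cons a fun j => value (x j) : Fin (k + 1) → ℕ → M) i) := by
        ext i
        refine Fin.cases ?_ (fun i => ?_) i <;> rfl
      have h₂ : ∀ s, (Fin.cons (a s) fun j => value (x j) s : Fin (k + 1) → M) = fun i =>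
          (Fin.cons a fun j => value (x j) : Fin (k + 1) → ℕ → M) i s := by
        intro s
        ext i
        refine Fin.cases ?_ (fun i => ?_) i <;> rfl
      simp only [h₂]
      rw [h₁]
      exact Ultraproduct.realize_formula_cast (u := hyperfilter ℕ) φ _
    obtain ⟨z, hz⟩ := hT.exists_witness φ x
    refine ⟨z, (hcons _).2 ?_⟩
    filter_upwards [(hcons a).1 ha, hz.filter_mono Nat.hyperfilter_le_atTop] with s h₁ h₂
    exact h₂ _ h₁
  let H : L.Substructure Prd := ⟨Set.range el, fun {n} f x hx => by
    choose z hz using hx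
    obtain rfl : (fun j => el (z j)) = x := funext hz
    -- Closure under functions is the witness property for the graph `x₀ = f(x₁, …, xₙ)`.
    obtain ⟨y, hy⟩ := hwit
      (Term.equal (Term.var 0) (Term.func f fun j => Term.var j.succ) : L.Formula (Fin (n + 1))) z
      (Structure.funMap f fun j => el (z j)) (by simp [Formula.realize_equal])
    refine ⟨y, ?_⟩
    simpa [Formula.realize_equal] using hy⟩
  have hH : H.IsElementary := by
    refine H.isElementary_of_exists fun n φ x a ha => ?_
    choose z hz using fun j => (x j).2
    -- The quantified variable comes last in the Tarski–Vaught test and first in `hwit`; `g`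
    -- translates.
    let g : Empty ⊕ Fin (n + 1) → Fin (n + 1) :=
      Sum.elim Empty.elim (Fin.lastCases 0 fun j => j.succ)
    have key : ∀ a : Prd, (φ.toFormula.relabel g).Realize
        (Fin.cons a fun j => el (z j) : Fin (n + 1) → Prd) ↔
        φ.Realize default (Fin.snoc ((↑) ∘ x) a : Fin (n + 1) → Prd) := by
      intro a
      rw [Formula.realize_relabel, BoundedFormula.realize_toFormula]
      have h₁ : (Fin.cons a fun j => el (z j) : Fin (n + 1) → Prd) ∘ g ∘ Sum.inr =
          (Fin.snoc ((↑) ∘ x) a : Fin (n + 1) → Prd) := by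
        ext j
        refine Fin.lastCases ?_ (fun j => ?_) j
        · simp [g]
        · simp [g, hz]
      rw [Function.comp_assoc, Function.comp_assoc, h₁,
        Subsingleton.elim (_ ∘ g ∘ Sum.inl) (default : Empty → Prd)]
    obtain ⟨y, hy⟩ := hwit _ z a ((key a).2 ha)
    exact ⟨⟨el y, y, rfl⟩, (key _).1 hy⟩
  -- The substructure lives in the universe of `M`; as a quotient of `T.Point` it is transported to
  -- `Type`.
  let N : Type := Quotient (Setoid.ker el)
  let e : H ≃ N := (Setoid.quotientKerEquivRange el).symm
  let _ : L.Structure N := e.inducedStructure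
  let E : H ≃[L] N := e.inducedStructureEquiv
  let F : N ↪ₑ[L] Prd :=
    (ElementarySubstructure.subtype ⟨H, hH⟩).comp E.symm.toElementaryEmbedding
  have hF : ∀ x, F (Quotient.mk _ x) = el x := fun x => rfl
  have hreal : ∀ {α : Type} (φ : L.Formula α) (x : α → T.Point),
      (φ.Realize fun j => (Quotient.mk _ (x j) : N)) ↔
      ∀ᶠ s in hyperfilter ℕ, φ.Realize fun j => value (x j) s := fun φ x => by
    rw [← hel, ← F.map_formula]
    rfl
  refine ⟨N, inferInstance, Quotient.mk _, Quotient.mk_surjective, fun k φ x => ?_, ?_⟩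
  · rw [hreal, hT.eventually_hyperfilter]
  · refine ElementarilyEquivalent.trans ?_ F.elementarilyEquivalent.symm
    rw [elementarilyEquivalent_iff]
    intro φ
    rw [Ultraproduct.sentence_realize, eventually_const]

section Borel

theorem measurable_thread (T : Tower L cl) {s₀ s : ℕ} (i : (T.S s₀).Name) (h : s₀ ≤ s) :
    Measurable fun b => T.thread b i h := by
  induction s, h using Nat.le_induction with
  | base => simp
  | succ s h ih =>
    simp only [T.thread_succ _ i h]
    exact (Measurable.of_discrete (f := fun p : Bool × (T.S s).Name => T.c s p.1 p.2)).comp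
      ((measurable_pi_apply s).prodMk ih)

theorem measurable_name (s : ℕ) : Measurable fun x : T.Point => name x s := by
  refine measurable_from_prod_countable_right fun a => ?_
  by_cases h : a.1 ≤ s
  · simpa only [name, dif_pos h] using measurable_thread T a.2 h
  · simpa only [name, dif_neg h] using measurable_thread T T.root s.zero_le

/-- At a fixed step, truth depends only on the tuple of names, which takes finitely many values and
is a measurable function of the points. -/
theorem measurableSet_eventually_realize {k : ℕ} (φ : L.Formula (Fin k)) :
    MeasurableSet {x : Fin k → T.Point | ∀ᶠ s in atTop, φ.Realize fun j => value (x j) s} := by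
  simp only [eventually_atTop, Set.ofPred_exists, Set.ofPred_forall]
  refine MeasurableSet.iUnion fun n => MeasurableSet.iInter fun s => MeasurableSet.iInter fun _ => ?_
  have : Measurable fun (x : Fin k → T.Point) (j : Fin k) => name (x j) s :=
    measurable_pi_lambda _ fun j => (measurable_name s).comp (measurable_pi_apply j)
  exact this (MeasurableSet.of_discrete
    (s := {f : Fin k → (T.S s).Name | φ.Realize fun j => (T.S s).val (f j)}))

theorem IsLimit.mk_eq_iff {N : Type} [L.Structure N] {mk : T.Point → N} (h : T.IsLimit mk)
    (x y : T.Point) : mk x = mk y ↔ ∀ᶠ s in atTop, value x s = value y s := by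
  have := h.realize_iff 2 (FirstOrder.Language.Term.equal (.var 0) (.var 1)) ![x, y]
  simpa [FirstOrder.Language.Formula.realize_equal] using this

theorem IsLimit.isBorelStructure {N : Type} [L.Structure N] {mk : T.Point → N}
    (h : T.IsLimit mk) : IsBorelStructure L N := by
  have hE : MeasurableSet {p : T.Point × T.Point | mk p.1 = mk p.2} := by
    have := measurableSet_eventually_realize (T := T)
      (FirstOrder.Language.Term.equal (.var 0) (.var 1) : L.Formula (Fin 2))
    have hm : Measurable fun p : T.Point × T.Point => ![p.1, p.2] :=
      measurable_pi_lambda _ fun j => by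
        fin_cases j
        exacts [measurable_fst, measurable_snd]
    convert! hm this using 1
    ext p
    simp [h.mk_eq_iff, FirstOrder.Language.Formula.realize_equal]
  refine ⟨T.Point, inferInstance, inferInstance, Set.univ,
    Setoid.ker fun z : (Set.univ : Set T.Point) => mk z,
    Setoid.quotientKerEquivOfSurjective _ fun y => ?_, MeasurableSet.univ, ?_, fun k φ _ => ?_⟩
  · obtain ⟨x, hx⟩ := h.surjective y
    exact ⟨⟨x, trivial⟩, hx⟩
  · convert! hE using 1
    ext p
    exact ⟨fun ⟨_, _, h⟩ => h, fun h => ⟨trivial, trivial, h⟩⟩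
  · convert! measurableSet_eventually_realize (T := T) φ using 1
    ext z
    rw [Set.mem_ofPred_eq, Set.mem_ofPred_eq, ← h.realize_iff]
    exact ⟨fun ⟨_, h⟩ => h, fun h => ⟨fun _ => trivial, h⟩⟩

end Borel

/-! ### The independent family -/

/-- The point that follows the root along `η`. -/
def branch (T : Tower L cl) (η : ℕ → Bool) : T.Point :=
  -- In the steps from `2 ^ ℓ - 1` to `2 ^ (ℓ + 1) - 2` the logarithm is `ℓ`, and each of the nodes
  -- `0, …, 2 ^ ℓ - 1` is split once; `η ℓ` governs this whole round.
  (⟨0, T.root⟩, fun s => η (Nat.log 2 (s + 1)))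

/-- The number with binary digits `η 0, …, η (ℓ - 1)`, which is the node reached by the branch along
`η` after all nodes have been split `ℓ` times. -/
def digitSum (η : ℕ → Bool) : ℕ → ℕ
  | 0 => 0
  | ℓ + 1 => digitSum η ℓ + if η ℓ then 2 ^ ℓ else 0

theorem digitSum_lt (η : ℕ → Bool) (ℓ : ℕ) : digitSum η ℓ < 2 ^ ℓ := by
  induction ℓ with
  | zero => simp [digitSum]
  | succ ℓ ih =>
    rw [digitSum, pow_succ]
    split_ifs <;> omega

theorem eq_of_digitSum_eq {η τ : ℕ → Bool} {ℓ : ℕ} (h : digitSum η ℓ = digitSum τ ℓ) :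
    ∀ j < ℓ, η j = τ j := by
  induction ℓ with
  | zero => simp
  | succ ℓ ih =>
    have h₁ := digitSum_lt η ℓ
    have h₂ := digitSum_lt τ ℓ
    rw [digitSum, digitSum] at h
    have h₃ : η ℓ = τ ℓ ∧ digitSum η ℓ = digitSum τ ℓ := by
      cases hη : η ℓ <;> cases hτ : τ ℓ <;> simp [hη, hτ] at h ⊢ <;> omega
    intro j hj
    rcases Nat.lt_succ_iff_lt_or_eq.1 hj with hj | rfl
    exacts [ih h₃.2 j hj, h₃.1]

theorem name_branch_free (η : ℕ → Bool) (s : ℕ) : name (T.branch η) s ∈ (T.S s).free := by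
  induction s with
  | zero => simpa [branch, name_mk] using T.root_free
  | succ s ih =>
    rw [name_succ _ s.zero_le]
    exact (T.refines s _).free _ ih

theorem supp_branch_succ (η : ℕ → Bool) {s x : ℕ}
    (h : (T.S s).supp (name (T.branch η) s) = {x}) :
    (T.S (s + 1)).supp (name (T.branch η) (s + 1)) =
      {nodeStep s (η (Nat.log 2 (s + 1))) x} := by
  rw [supp_name_succ _ s.zero_le, h, Finset.image_singleton]
  rfl

theorem supp_branch (η : ℕ → Bool) (ℓ : ℕ) :
    (T.S (2 ^ ℓ - 1)).supp (name (T.branch η) (2 ^ ℓ - 1)) = {digitSum η ℓ} := by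
  have hpos : ∀ ℓ, 0 < 2 ^ ℓ := fun ℓ => by positivity
  -- After `r` steps of round `ℓ` exactly the nodes below `r` have been split, so the digit `2 ^ ℓ`
  -- has been added only if the branch was at one of them.
  have key : ∀ ℓ, (T.S (2 ^ ℓ - 1)).supp (name (T.branch η) (2 ^ ℓ - 1)) = {digitSum η ℓ} →
      ∀ r ≤ 2 ^ ℓ, (T.S (2 ^ ℓ - 1 + r)).supp (name (T.branch η) (2 ^ ℓ - 1 + r)) =
        {digitSum η ℓ + if η ℓ ∧ digitSum η ℓ < r then 2 ^ ℓ else 0} := by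
    intro ℓ h₀ r
    induction r with
    | zero => simpa using h₀
    | succ r ih =>
      intro hr
      have hs : 2 ^ ℓ - 1 + r + 1 = 2 ^ ℓ + r := by have := hpos ℓ; omega
      have hlog : Nat.log 2 (2 ^ ℓ - 1 + r + 1) = ℓ := by
        rw [hs, Nat.log_eq_iff (by simp)]
        rw [pow_succ]
        omega
      have := supp_branch_succ η (ih (by omega))
      rw [← add_assoc, this, hlog, nodeStep, splitNode, hlog, hs]
      have hd := digitSum_lt η ℓ
      congr 1
      cases hη : η ℓ
      · simp
      · simp only [true_and]
        split_ifs <;> omega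
  induction ℓ with
  | zero =>
    simpa [branch, name_mk, digitSum] using T.root_supp
  | succ ℓ ih =>
    have := key ℓ ih (2 ^ ℓ) le_rfl
    have hs : 2 ^ (ℓ + 1) - 1 = 2 ^ ℓ - 1 + 2 ^ ℓ := by
      have := hpos ℓ
      rw [pow_succ]
      omega
    rw [hs, this, digitSum]
    simp [digitSum_lt]

theorem name_branch_congr {η τ : ℕ → Bool} {ℓ : ℕ} (h : ∀ j < ℓ, η j = τ j) :
    name (T.branch η) (2 ^ ℓ - 1) = name (T.branch τ) (2 ^ ℓ - 1) := by
  suffices ∀ s < 2 ^ ℓ, name (T.branch η) s = name (T.branch τ) s from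
    this _ (Nat.sub_lt (by positivity) one_pos)
  intro s
  induction s with
  | zero => simp [branch, name_mk]
  | succ s ih =>
    intro hs
    rw [name_succ _ s.zero_le, name_succ _ s.zero_le, ih (by omega)]
    congr 1
    exact h _ (Nat.log_lt_of_lt_pow (by simp) hs)

/-- The supports differ once the digit at which `η` and `τ` differ has been read, and `nodePred`
recovers earlier supports from later ones, so they never become equal again. -/
theorem eventually_name_branch_ne {η τ : ℕ → Bool} (h : η ≠ τ) :
    ∀ᶠ s in atTop, name (T.branch η) s ≠ name (T.branch τ) s := by
  obtain ⟨n, hn⟩ := Function.ne_iff.1 h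
  refine eventually_atTop.2 ⟨2 ^ (n + 1) - 1, fun s hs => ?_⟩
  suffices (T.S s).supp (name (T.branch η) s) ≠ (T.S s).supp (name (T.branch τ) s) from
    fun h => this (by rw [h])
  induction s, hs using Nat.le_induction with
  | base =>
    rw [supp_branch, supp_branch]
    exact fun h => hn (eq_of_digitSum_eq (Finset.singleton_injective h) n n.lt_succ_self)
  | succ s hs ih =>
    intro h
    refine ih ?_
    have himg : ∀ η : ℕ → Bool, ((T.S (s + 1)).supp (name (T.branch η) (s + 1))).image (nodePred s)
        = (T.S s).supp (name (T.branch η) s) := by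
      intro η
      simpa [nodes] using image_nodePred_nodes (x := fun _ : Unit => T.branch η) (s := s)
        fun _ => s.zero_le
    rw [← himg η, ← himg τ, h]

theorem value_branch_notMem {η : ℕ → Bool} {n : ℕ} {τ : Fin n → ℕ → Bool} {s : ℕ}
    (h : ∀ j, name (T.branch η) s ≠ name (T.branch (τ j)) s) :
    value (T.branch η) s ∉ cl (Set.range fun j => value (T.branch (τ j)) s) := by
  intro hmem
  refine (T.S s).independent _ (name_branch_free η s) (cl.monotone ?_ hmem)
  rintro _ ⟨j, rfl⟩
  exact ⟨_, ⟨name_branch_free (τ j) s, fun h' => h j h'.symm⟩, rfl⟩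

section Family

variable {N : Type} [L.Structure N] {mk : T.Point → N}

theorem IsLimit.branch_injective (h : T.IsLimit mk) :
    Function.Injective fun η => mk (T.branch η) := by
  intro η τ heq
  by_contra hne
  obtain ⟨s, h₁, h₂⟩ := (((h.mk_eq_iff _ _).1 heq).and (eventually_name_branch_ne (T := T) hne)).exists
  refine value_branch_notMem (τ := fun _ : Fin 1 => τ) (fun _ => h₂) ?_
  exact cl.le_closure _ ⟨0, h₁.symm⟩

theorem IsLimit.isClIndependent (h : T.IsLimit mk) :
    IsClIndependent L cl (Set.range fun η => mk (T.branch η)) := by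
  rintro _ ⟨η, rfl⟩ ⟨n, b, φ, hφ, hb, hr⟩
  choose τ hτ using fun j => (hb j).1
  have hne : ∀ j, η ≠ τ j := by
    rintro j rfl
    exact (hb j).2 (hτ j).symm
  have hcons : (Fin.cons (mk (T.branch η)) b : Fin (n + 1) → N) = fun i =>
      mk ((Fin.cons (T.branch η) fun j => T.branch (τ j) : Fin (n + 1) → T.Point) i) := by
    ext i
    refine Fin.cases rfl (fun i => ?_) i
    simpa using (hτ i).symm
  have hcons' : ∀ s, (fun i =>
      value ((Fin.cons (T.branch η) fun j => T.branch (τ j) : Fin (n + 1) → T.Point) i) s) =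
      (Fin.cons (value (T.branch η) s) fun j => value (T.branch (τ j)) s : Fin (n + 1) → M) := by
    intro s
    ext i
    refine Fin.cases rfl (fun i => rfl) i
  rw [hcons, h.realize_iff] at hr
  obtain ⟨s, h₁, h₂⟩ :=
    (hr.and (eventually_all.2 fun j => eventually_name_branch_ne (T := T) (hne j))).exists
  rw [hcons'] at h₁
  exact value_branch_notMem h₂ (hφ _ _ h₁)

/-- At step `2 ^ ℓ - 1` the `k` branches occupy `k` distinct nodes, already the maximum for
singleton supports. -/
theorem exists_stableFrom_branch {ℓ k : ℕ} {η : Fin k → ℕ → Bool} (hη : SplitsBy ℓ η) :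
    ∃ β, StableFrom (fun i => T.branch (η i)) (2 ^ ℓ - 1) β := by
  refine exists_stableFrom_of_card_le (fun _ => Nat.zero_le _) fun s' _ => ?_
  have h₁ : (nodes (fun i => T.branch (η i)) s').card ≤ k := by
    refine Finset.card_biUnion_le.trans ((Finset.sum_le_card_nsmul _ _ 1 fun i _ => ?_).trans ?_)
    · refine (card_supp_name_le _ (Nat.zero_le _)).trans ?_
      simp [branch, T.root_supp]
    · simp
  have h₂ : nodes (fun i => T.branch (η i)) (2 ^ ℓ - 1) =
      Finset.univ.image fun i => digitSum (η i) ℓ := by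
    rw [nodes]
    simp only [supp_branch]
    ext
    simp [eq_comm]
  rw [h₂, Finset.card_image_of_injective]
  · simpa using h₁
  · intro i j hij
    exact hη (funext fun m => eq_of_digitSum_eq hij m m.2)

/-- Similar tuples have the same names at step `2 ^ ℓ - 1`. There `P` decides `θ`, and both tuples
are stable from then on, though possibly with different choices `β` and `β'`. -/
theorem IsLimit.isAsymptoticallySimilar (h : T.IsLimit mk) (hT : T.IsRich) :
    IsAsymptoticallySimilar L fun η => mk (T.branch η) := by
  intro k θ
  obtain ⟨s₀, h₀⟩ := hT.decides k θ
  refine ⟨s₀, fun ℓ hℓ η τ hητ => ?_⟩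
  have hs : s₀ ≤ 2 ^ ℓ - 1 := by
    have := Nat.lt_two_pow_self (n := ℓ)
    omega
  have hτ : SplitsBy ℓ τ := by
    have : (fun i (j : Fin ℓ) => τ i j) = fun i (j : Fin ℓ) => η i j := by
      ext i j
      exact (hητ.2 i j j.2).symm
    rw [SplitsBy, this]
    exact hητ.1
  obtain ⟨β, hβ⟩ := exists_stableFrom_branch (T := T) hητ.1
  obtain ⟨β', hβ'⟩ := exists_stableFrom_branch (T := T) hτ
  have hname : ∀ i, name (T.branch (τ i)) (2 ^ ℓ - 1) = name (T.branch (η i)) (2 ^ ℓ - 1) :=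
    fun i => (name_branch_congr (hητ.2 i)).symm
  rw [h.realize_iff, h.realize_iff]
  rcases h₀ _ hs fun i => name (T.branch (η i)) (2 ^ ℓ - 1) with hd | hd
  · refine iff_of_true (eventually_atTop.2 ⟨_, fun s hs => hβ.value_mem hs
      (d := {w | θ.Realize w}) hd⟩) (eventually_atTop.2 ⟨_, fun s hs => hβ'.value_mem hs
      (d := {w | θ.Realize w}) ?_⟩)
    simp only [hname]
    exact hd
  · have hfalse : ∀ {x : Fin k → T.Point}, (∀ s ≥ 2 ^ ℓ - 1, ¬ θ.Realize fun j => value (x j) s) →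
        ¬ ∀ᶠ s in atTop, θ.Realize fun j => value (x j) s := fun hx hev => by
      obtain ⟨s, h₁, h₂⟩ := (hev.and (eventually_ge_atTop (2 ^ ℓ - 1))).exists
      exact hx s h₂ h₁
    refine iff_of_false (hfalse fun s hs => hβ.value_mem hs (d := {w | ¬ θ.Realize w}) hd)
      (hfalse fun s hs => hβ'.value_mem hs (d := {w | ¬ θ.Realize w}) ?_)
    simp only [hname]
    exact hd

theorem IsLimit.mk_eq_continuum (h : T.IsLimit mk) : Cardinal.mk N = Cardinal.continuum := by
  refine le_antisymm ((Cardinal.mk_le_of_surjective h.surjective).trans ?_) ?_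
  · rw [Cardinal.mk_prod, Cardinal.lift_id, Cardinal.lift_id]
    refine (mul_le_mul_left (Cardinal.mk_le_aleph0 (α := Σ s, (T.S s).Name)) _).trans ?_
    simp
  · have := Cardinal.mk_le_of_injective h.branch_injective
    simpa using this

end Family

end Tower

/-! ### Meeting countably many requirements -/

namespace Tower

variable {L : FirstOrder.Language.{u, v}} {M : Type w} [L.Structure M]
  {cl : ClosureOperator (Set M)}

theorem definable_witness_imp {k : ℕ} (φ : L.Formula (Fin (k + 1))) :
    (∅ : Set M).Definable L {x : Fin (k + 1) → M |
      (∃ y : M, φ.Realize (Fin.cons y (Fin.tail x) : Fin (k + 1) → M)) → φ.Realize x} := by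
  have hφ : (∅ : Set M).Definable L {x : Fin (k + 1) → M | φ.Realize x} :=
    Set.empty_definable_iff.2 ⟨φ, rfl⟩
  convert! ((hφ.image_comp (Fin.succ : Fin k → Fin (k + 1))).preimage_comp Fin.succ).compl.union hφ
    using 1
  ext x
  rw [Set.mem_union, Set.mem_compl_iff, ← imp_iff_not_or]
  refine imp_congr ⟨?_, ?_⟩ Iff.rfl
  · rintro ⟨y, hy⟩
    exact ⟨_, hy, rfl⟩
  · rintro ⟨z, hz, hzx⟩
    refine ⟨z 0, ?_⟩
    have : (Fin.cons (z 0) (Fin.tail x) : Fin (k + 1) → M) = z := by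
      conv_rhs => rw [← Fin.cons_self_tail z]
      exact congrArg _ hzx.symm
    rwa [this]

/-- There are rich towers that moreover meet countably many requirements, each asking that tuples
eventually be confined to a member of a given cover by definable sets. -/
theorem exists_isRich [Countable L.Symbols] (hcl : IsSufficientPregeometry L cl)
    {J : Type} [Countable J] {m : J → ℕ} (D : ∀ j, Set (Set (Fin (m j) → M)))
    (hD : ∀ j, ∀ d ∈ D j, (∅ : Set M).Definable L d) (hcover : ∀ j x, ∃ d ∈ D j, x ∈ d) :
    ∃ T : Tower L cl, T.IsRich ∧
      ∀ j, ∃ s₀, ∀ s ≥ s₀, ∀ f : Fin (m j) → (T.S s).Name, ∃ d ∈ D j, ∀ w ∈ (T.S s).P, w ∘ f ∈ d := by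
  have : Nonempty (Σ k, L.Formula (Fin k)) := ⟨⟨0, ⊥⟩⟩
  have : Nonempty (Σ k, L.Formula (Fin (k + 1))) := ⟨⟨0, ⊥⟩⟩
  obtain ⟨q, hq⟩ := exists_surjective_nat (Σ k, L.Formula (Fin (k + 1)))
  obtain ⟨r, hr⟩ := exists_surjective_nat ((Σ k, L.Formula (Fin k)) ⊕ J)
  let arity : (Σ k, L.Formula (Fin k)) ⊕ J → ℕ := Sum.elim Sigma.fst m
  let D' : ∀ j, Set (Set (Fin (arity j) → M)) := fun j => match j with
    | Sum.inl φ => {{x | φ.2.Realize x}, {x | φ.2.Realize x}ᶜ}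
    | Sum.inr j => D j
  have hD' : ∀ j, ∀ d ∈ D' j, (∅ : Set M).Definable L d := by
    rintro (φ | j) d hd
    · have hφ : (∅ : Set M).Definable L {x : Fin φ.1 → M | φ.2.Realize x} :=
        Set.empty_definable_iff.2 ⟨φ.2, rfl⟩
      rcases hd with rfl | rfl
      exacts [hφ, hφ.compl]
    · exact hD j d hd
  have hcover' : ∀ j x, ∃ d ∈ D' j, x ∈ d := by
    rintro (φ | j) x
    · by_cases h : φ.2.Realize x
      · exact ⟨_, Or.inl rfl, h⟩
      · exact ⟨_, Or.inr rfl, h⟩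
    · exact hcover j x
  obtain ⟨T, h₁, h₂⟩ := exists_tower hcl
    (fun j => {x : Fin ((q j).1 + 1) → M |
      (∃ y : M, (q j).2.Realize (Fin.cons y (Fin.tail x) : Fin ((q j).1 + 1) → M)) →
        (q j).2.Realize x})
    (fun j => definable_witness_imp _)
    (fun j x => by
      by_cases h : ∃ y : M, (q j).2.Realize (Fin.cons y x : Fin ((q j).1 + 1) → M)
      · obtain ⟨y, hy⟩ := h
        exact ⟨y, fun _ => hy⟩
      -- Without a solution the implication is vacuous, so any element serves as witness.
      · refine ⟨(hcl.infinite.nonempty).some, fun h' => absurd ?_ h⟩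
        simpa using h')
    (fun j => D' (r j)) (fun j => hD' (r j)) (fun j => hcover' (r j))
  have h₃ : ∀ j, ∃ s₀, ∀ s ≥ s₀, ∀ f : Fin (arity j) → (T.S s).Name, ∃ d ∈ D' j,
      ∀ w ∈ (T.S s).P, w ∘ f ∈ d := by
    intro j
    obtain ⟨n, rfl⟩ := hr j
    exact ⟨n + 1, fun s hs f => h₂ s n hs f⟩
  refine ⟨T, ⟨fun k φ => ?_, fun k φ => ?_⟩, fun j => h₃ (Sum.inr j)⟩
  · obtain ⟨s₀, h⟩ := h₃ (Sum.inl ⟨k, φ⟩)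
    refine ⟨s₀, fun s hs f => ?_⟩
    obtain ⟨d, rfl | rfl, hd⟩ := h s hs f
    exacts [Or.inl hd, Or.inr hd]
  · obtain ⟨n, hn⟩ := hq ⟨k, φ⟩
    refine ⟨n + 1, fun s hs b => ?_⟩
    have := h₁ s n hs b
    rw [hn] at this
    intro f
    obtain ⟨t, ht⟩ := this f
    exact ⟨t, fun w hw y hy => ht w hw ⟨y, hy⟩⟩

theorem exists_eventually_mem {T : Tower L cl} {m : ℕ} {D : Set (Set (Fin m → M))}
    (hD : ∃ s₀, ∀ s ≥ s₀, ∀ f : Fin m → (T.S s).Name, ∃ d ∈ D, ∀ w ∈ (T.S s).P, w ∘ f ∈ d)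
    (x : Fin m → T.Point) : ∃ d ∈ D, ∀ᶠ s in atTop, (fun j => value (x j) s) ∈ d := by
  obtain ⟨s₀, h₀⟩ := hD
  obtain ⟨s₁, β, h₁⟩ := exists_stableFrom x
  have h₁ := h₁.mono (le_max_right s₀ s₁)
  obtain ⟨d, hd, hmem⟩ := h₀ _ (le_max_left s₀ s₁) fun j => name (x j) _
  exact ⟨d, hd, eventually_atTop.2 ⟨_, fun s hs => h₁.value_mem hs hmem⟩⟩

end Tower

theorem theorem6p2p3 (L : FirstOrder.Language.{u, v}) [Countable L.Symbols] (M : Type w) [L.Structure M]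
    (cl : ClosureOperator (Set M)) (hcl : IsSufficientPregeometry L cl)
    (k : ℕ → ℕ) (Δ : (m : ℕ) → Set (L.Formula (Fin (k m)))) (hΔ : ∀ m, OmitsType M (Δ m)) :
    ∃ (N : Type) (_ : L.Structure N),
      L.ElementarilyEquivalent M N ∧
      IsBorelStructure L N ∧
      Cardinal.mk N = Cardinal.continuum ∧
      (∃ a : (ℕ → Bool) → N, Function.Injective a ∧
        IsClIndependent L cl (Set.range a) ∧ IsAsymptoticallySimilar L a) ∧
      (IsAtomicModel L M → IsAtomicModel L N) ∧
      ∀ m, OmitsType N (Δ m) := by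
  -- The first covers consist of the sets where some formula of `Δ m` fails; they cover because `M`
  -- omits `Δ m`. The second consist of definable sets inside the solution set of a complete
  -- formula. If `M` is not atomic, this condition is void and the whole space is a member.
  let D : ∀ j : ℕ ⊕ ℕ, Set (Set (Fin (Sum.elim k id j) → M)) := fun j => match j with
    | Sum.inl m => {d | ∃ δ ∈ Δ m, d = {x | δ.Realize x}ᶜ}
    | Sum.inr n => {d | (∅ : Set M).Definable L d ∧ (IsAtomicModel L M →
        ∃ φ : L.Formula (Fin n), IsCompleteFormula (L.completeTheory M) φ ∧ d ⊆ {x | φ.Realize x})}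
  have hdef : ∀ {n : ℕ} (φ : L.Formula (Fin n)),
      (∅ : Set M).Definable L {x : Fin n → M | φ.Realize x} := fun φ =>
    Set.empty_definable_iff.2 ⟨φ, rfl⟩
  obtain ⟨T, hT, hreq⟩ := Tower.exists_isRich hcl D (by
    rintro (m | n) d hd
    · obtain ⟨δ, -, rfl⟩ := hd
      exact (hdef δ).compl
    · exact hd.1) (by
    rintro (m | n) x
    · obtain ⟨δ, hδ, hx⟩ := hΔ m x
      exact ⟨_, ⟨δ, hδ, rfl⟩, hx⟩
    · by_cases hM : IsAtomicModel L M
      · obtain ⟨φ, hφ, hx⟩ := hM n x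
        exact ⟨_, ⟨hdef φ, fun _ => ⟨φ, hφ, subset_rfl⟩⟩, hx⟩
      · exact ⟨Set.univ, ⟨Set.definable_univ, fun h => absurd h hM⟩, trivial⟩)
  obtain ⟨N, _, mk, h⟩ := hT.exists_isLimit
  refine ⟨N, inferInstance, h.equivalent, h.isBorelStructure, h.mk_eq_continuum,
    ⟨fun η => mk (T.branch η), h.branch_injective, h.isClIndependent,
      h.isAsymptoticallySimilar hT⟩, fun hM n a => ?_, fun m a => ?_⟩
  · choose x hx using fun j => h.surjective (a j)
    obtain rfl : (fun j => mk (x j)) = a := funext hx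
    obtain ⟨d, ⟨-, hd⟩, hev⟩ := Tower.exists_eventually_mem (hreq (Sum.inr n)) x
    obtain ⟨φ, hφ, hdφ⟩ := hd hM
    have heq : L.completeTheory M = L.completeTheory N := h.equivalent
    refine ⟨φ, heq ▸ hφ, (h.realize_iff _ _ _).2 (hev.mono fun s hs => hdφ hs)⟩
  · choose x hx using fun j => h.surjective (a j)
    obtain rfl : (fun j => mk (x j)) = a := funext hx
    obtain ⟨d, ⟨δ, hδ, rfl⟩, hev⟩ := Tower.exists_eventually_mem (hreq (Sum.inl m)) x
    refine ⟨δ, hδ, fun hr => ?_⟩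
    obtain ⟨s, h₁, h₂⟩ := (hev.and ((h.realize_iff _ _ _).1 hr)).exists
    exact h₁ h₂
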